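/- Definitions. Let $U\subset\mathbb R$ be an open set containing $0$. A $C^\infty$ map $P\colon U\to\mathbb R$ is called parabolic (at $0$) if $P(0)=0$, $P'(0)=1$ and $P''(0)\neq 0$, that is, $P(x)=x+ax^2+\dots$ with $a\ne 0$; such maps are exactly the representatives of $C^\infty$ parabolic germs at $0$. Let $V\subset U$ be an open interval containing $0$. A (Takens) generator of $P$ on $V$ is a $C^\infty$ vector field $u(x)=ax^2+\dots$ on $V$ (that is, $u(0)=u'(0)=0$ and $u''(0)=P''(0)$) whose time-one map is $P$: for every $x\in V$ with $P(x)\in V$ there is a solution $\gamma\colon[0,1]\to V$ of $\dot\gamma=u(\gamma)$ with $\gamma(0)=x$ and $\gamma(1)=P(x)$. Proposition. Let $P\colon U\to\mathbb R$ be a $C^\infty$ representative, on an open set $U\ni 0$, of a parabolic germ at $0$. Then there exists an open interval $V\subset U$ containing $0$ such that $P$ has a generator on $V$ and the following holds. For every $\varepsilon>0$ there exists $\delta>0$ such that, for every $C^\infty$ parabolic map $Q\colon U\to\mathbb R$ with $$|Q^{(k)}(x)-P^{(k)}(x)|<\delta\qquad\text{for all } x\in U \text{ and } 0\le k\le 4,$$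 the map $Q$ has a generator on $V$, and for every generator $u$ of $P$ on $V$ and every generator $v$ of $Q$ on $V$, $$|v(x)-u(x)|<\varepsilon\qquad\text{for all } x\in V.$$ -/

import Mathlib

open Set
open scoped ContDiff

/-- `P`, restricted to the open set `U ∋ 0`, is a `C^∞` representative of a parabolic germ at `0`,
i.e. of a germ `P(x) = x + a x ^ 2 + ⋯` with `a ≠ 0`. Values of `P` outside `U` are irrelevant. -/
structure IsParabolicOn (P : ℝ → ℝ) (U : Set ℝ) : Prop where
  isOpen : IsOpen U
  zero_mem : (0 : ℝ) ∈ U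
  smooth : ContDiffOn ℝ ∞ P U
  map_zero : P 0 = 0
  deriv_zero : deriv P 0 = 1
  deriv_two_ne : iteratedDeriv 2 P 0 ≠ 0

/-- The time-one map of the autonomous vector field `u` on `V` is `P`: whenever `x` and `P x` both
lie in `V`, the integral curve of `u` that starts at `x` stays in `V` for times in `[0, 1]` and is at
`P x` at time `1`. -/
def TimeOneMapOn (u P : ℝ → ℝ) (V : Set ℝ) : Prop :=
  ∀ x ∈ V, P x ∈ V → ∃ γ : ℝ → ℝ, γ 0 = x ∧ γ 1 = P x ∧ (∀ t ∈ Icc (0 : ℝ) 1, γ t ∈ V) ∧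
    IsIntegralCurveOn γ (fun _ => u) (Icc 0 1)

/-- `u` is a (Takens) generator of the parabolic map `P` on the open set `V ∋ 0`: a `C^∞` vector field
`u(x) = a x ^ 2 + ⋯` on `V` (with the same `a` as in `P(x) = x + a x ^ 2 + ⋯`) whose time-one map
is `P`. -/
structure IsGeneratorOn (u P : ℝ → ℝ) (V : Set ℝ) : Prop where
  smooth : ContDiffOn ℝ ∞ u V
  map_zero : u 0 = 0
  deriv_zero : deriv u 0 = 0
  deriv_two : iteratedDeriv 2 u 0 = iteratedDeriv 2 P 0
  timeOne : TimeOneMapOn u P V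

/-- `P` and `Q` are `δ`-close in the `C^k` sense on the open set `U`. -/
def CkClose (k : ℕ) (P Q : ℝ → ℝ) (U : Set ℝ) (δ : ℝ) : Prop :=
  ∀ j ≤ k, ∀ x ∈ U, |iteratedDeriv j Q x - iteratedDeriv j P x| < δ

/-! Generators correspond to invariant vector fields. A generator `u` satisfies `u (P x) = P' x * u
x` near `0`, and conversely an invariant field with the quadratic coefficient of `P` has time-one
map `P`. It remains to construct an invariant field, prove that it is unique, and control its
dependence on the map.

Conjugating by `x ↦ -x` if necessary, let `P'' 0 < 0`. Then `P` attracts to `0` from the right, and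
the inverse of `P`, reflected, attracts in the same way on the other side. Both are a
`ParabolicContraction` `R`: orbits decay like `1 / n` and `(R x) ^ 3 ≤ x ^ 3 * R' x`. The explicit
`cubicField` is invariant up to `O(x ^ 5)`. Successive pullbacks of it by `R^[n]` differ by the
pullback of this defect, which the cube inequality bounds by a multiple of `(R^[n] x) ^ 2 * x ^ 3`,
hence of `x ^ 3 / n ^ 2`. So the pullbacks converge, and the limit is invariant.

For smoothness at `0`, `cubicField` may be replaced by a field `w` whose defect is `O(x ^ (k + 6))`
without changing the limit (`exists_formal_invariant`, `tendsto_pullbackLim_of_isBigO`). The limit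
is then `w` plus a series that converges with its derivatives up to order `k`, all tending to `0` at
`0` (`exists_smooth_limit`), so the two halves glue to every finite order.

Two invariant fields have a ratio that is constant along orbits, which settles uniqueness
(`eq_of_invariant`). A primitive `F` of `1 / u` is shifted by a constant under `R`; the limit at `0`
computes the constant (`time_translation`), so `R` or its inverse is the time-one map.

For continuity, `C^4`-closeness gives third-order expansions with common constants on a common
interval (`exists_expansion`). The tails of the pullback sequences are then uniformly small, while
each finite pullback depends continuously on the map, its derivative and its 3-jet at `0`
(`tendstoUniformlyOn_pullbackLim`). -/

open Filter Topology

/-! ### One-sided parabolic contractions and limits of pullbacks. -/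

/-- A map of `[0, b]` that contracts towards the parabolic fixed point `0`. -/
structure ParabolicContraction (R : ℝ → ℝ) (c b : ℝ) : Prop where
  b_pos : 0 < b
  c_pos : 0 < c
  map_zero : R 0 = 0
  pos : ∀ x ∈ Ioc 0 b, 0 < R x
  le : ∀ x ∈ Icc 0 b, R x ≤ x - c * x ^ 2
  half_le : ∀ x ∈ Icc 0 b, 1 / 2 ≤ deriv R x
  le_one : ∀ x ∈ Icc 0 b, deriv R x ≤ 1
  cube_le : ∀ x ∈ Icc 0 b, R x ^ 3 ≤ x ^ 3 * deriv R x

/-- The pullback of the vector field `w` by the map `R`. -/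
noncomputable def pullback (R w : ℝ → ℝ) (x : ℝ) : ℝ := w (R x) / deriv R x

/-- The limit of the pullbacks of `w` by the iterates of `R`. -/
noncomputable def pullbackLim (R w : ℝ → ℝ) (x : ℝ) : ℝ :=
  limUnder atTop (fun n => (pullback R)^[n] w x)

theorem pullback_sub (R v w : ℝ → ℝ) : pullback R (v - w) = pullback R v - pullback R w := by
  ext x; simp [pullback, sub_div]

theorem pullback_iterate_sub (R v w : ℝ → ℝ) (n : ℕ) :
    (pullback R)^[n] (v - w) = (pullback R)^[n] v - (pullback R)^[n] w := by
  induction n with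
  | zero => rfl
  | succ n ih => simp only [Function.iterate_succ_apply', ih, pullback_sub]

namespace ParabolicContraction

variable {R : ℝ → ℝ} {c b : ℝ}

theorem deriv_pos (h : ParabolicContraction R c b) {x : ℝ} (hx : x ∈ Icc 0 b) :
    0 < deriv R x := by linarith [h.half_le x hx]

theorem hasDerivAt (h : ParabolicContraction R c b) {x : ℝ} (hx : x ∈ Icc 0 b) :
    HasDerivAt R (deriv R x) x :=
  (differentiableAt_of_deriv_ne_zero (h.deriv_pos hx).ne').hasDerivAt

theorem map_lt (h : ParabolicContraction R c b) {x : ℝ} (hx : x ∈ Ioc 0 b) : R x < x := by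
  have h1 := h.le x ⟨hx.1.le, hx.2⟩
  have := mul_pos h.c_pos (pow_pos hx.1 2)
  linarith

theorem mapsTo_Ioc (h : ParabolicContraction R c b) : MapsTo R (Ioc 0 b) (Ioc 0 b) :=
  fun x hx => ⟨h.pos x hx, (h.map_lt hx).le.trans hx.2⟩

theorem mapsTo_Ioo (h : ParabolicContraction R c b) : MapsTo R (Ioo 0 b) (Ioo 0 b) :=
  fun x hx => ⟨h.pos x ⟨hx.1, hx.2.le⟩, (h.map_lt ⟨hx.1, hx.2.le⟩).trans hx.2⟩

theorem mapsTo_Icc (h : ParabolicContraction R c b) : MapsTo R (Icc 0 b) (Icc 0 b) := by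
  intro x hx
  rcases hx.1.eq_or_lt with h0 | h0
  · rw [← h0, h.map_zero]; exact ⟨le_rfl, h.b_pos.le⟩
  · exact Ioc_subset_Icc_self (h.mapsTo_Ioc ⟨h0, hx.2⟩)

theorem map_le (h : ParabolicContraction R c b) {x : ℝ} (hx : x ∈ Icc 0 b) : R x ≤ x := by
  have h1 := h.le x hx
  have := mul_nonneg h.c_pos.le (sq_nonneg x)
  linarith

theorem iterate_mem_Ioc (h : ParabolicContraction R c b) {x : ℝ} (hx : x ∈ Ioc 0 b) (n : ℕ) :
    R^[n] x ∈ Ioc 0 b := h.mapsTo_Ioc.iterate n hx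

theorem iterate_mem_Icc (h : ParabolicContraction R c b) {x : ℝ} (hx : x ∈ Icc 0 b) (n : ℕ) :
    R^[n] x ∈ Icc 0 b := h.mapsTo_Icc.iterate n hx

/-- With `t = c * y`, the comparison map `t ↦ t - t ^ 2` sends values at most `1 / (n + 1)` to
values at most `1 / (n + 2)`. The start `c * x ≤ 1` is forced by `0 < R x ≤ x - c * x ^ 2`. -/
theorem iterate_le (h : ParabolicContraction R c b) {x : ℝ} (hx : x ∈ Icc 0 b) (n : ℕ) :
    R^[n] x ≤ 1 / (c * (n + 1)) := by
  have hc := h.c_pos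
  induction n with
  | zero =>
    simp only [Function.iterate_zero, id, Nat.cast_zero, zero_add, mul_one]
    rcases hx.1.eq_or_lt with h0 | h0
    · rw [← h0]; positivity
    · have h1 := h.le x hx
      have h2 := h.pos x ⟨h0, hx.2⟩
      rw [le_div_iff₀ hc]
      by_contra hcon
      push Not at hcon
      nlinarith
  | succ n ih =>
    rw [Function.iterate_succ_apply']
    have hy := h.iterate_mem_Icc hx n
    set y := R^[n] x
    refine (h.le y hy).trans ?_
    rw [le_div_iff₀ (by positivity)] at ih ⊢
    push_cast
    have hn : (0 : ℝ) ≤ n := Nat.cast_nonneg n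
    have hcy : 0 ≤ c * y := mul_nonneg hc.le hy.1
    have h3 : c * y * (n + 1) ≤ 1 := by linarith
    have h4 : c * y * (1 - c * y) * (n + 1 + 1) ≤ 1 := by
      nlinarith [mul_nonneg hcy hcy, mul_nonneg hcy hn,
        mul_nonneg hcy (sub_nonneg.2 h3), sq_nonneg (c * y)]
    linarith

theorem tendsto_iterate (h : ParabolicContraction R c b) {x : ℝ} (hx : x ∈ Icc 0 b) :
    Tendsto (fun n => R^[n] x) atTop (𝓝 0) := by
  have h1 : Tendsto (fun n : ℕ => (1 / c) * (1 / ((n : ℝ) + 1))) atTop (𝓝 ((1 / c) * 0)) :=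
    tendsto_one_div_add_atTop_nhds_zero_nat.const_mul _
  rw [mul_zero] at h1
  refine squeeze_zero (fun n => (h.iterate_mem_Icc hx n).1) (fun n => ?_) h1
  have := h.iterate_le hx n
  rwa [one_div_mul_one_div]

/-- The pullback by the iterates divides by the derivative of the iterate. -/
theorem exists_iterate_pullback_eq (h : ParabolicContraction R c b) {x : ℝ} (hx : x ∈ Icc 0 b)
    (n : ℕ) : ∃ D > 0, (R^[n] x) ^ 3 ≤ x ^ 3 * D ∧
      ∀ w : ℝ → ℝ, (pullback R)^[n] w x = w (R^[n] x) / D := by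
  induction n generalizing x with
  | zero => exact ⟨1, one_pos, by simp, by simp⟩
  | succ n ih =>
    obtain ⟨D, hD, h1, h2⟩ := ih (h.mapsTo_Icc hx)
    -- `D` is the chain-rule product of derivatives along the orbit, and `cube_le` multiplies along
    -- the orbit in the same way.
    refine ⟨D * deriv R x, mul_pos hD (h.deriv_pos hx), ?_, fun w => ?_⟩
    · rw [Function.iterate_succ_apply]
      calc _ ≤ R x ^ 3 * D := h1
        _ ≤ x ^ 3 * deriv R x * D := mul_le_mul_of_nonneg_right (h.cube_le x hx) hD.le
        _ = _ := by ring
    · rw [Function.iterate_succ_apply', pullback, h2, div_div, Function.iterate_succ_apply]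

/-- Three powers of `R^[n] x` pay for the division by the derivative of the iterate; the remaining
`m` powers decay along the orbit. -/
theorem abs_iterate_pullback_le (h : ParabolicContraction R c b) {f : ℝ → ℝ} {K : ℝ} {m : ℕ}
    (hf : ∀ x ∈ Icc 0 b, |f x| ≤ K * x ^ (m + 3)) (hK : 0 ≤ K) {x : ℝ} (hx : x ∈ Icc 0 b) (n : ℕ) :
    |(pullback R)^[n] f x| ≤ K * (R^[n] x) ^ m * x ^ 3 := by
  obtain ⟨D, hD, h1, h2⟩ := h.exists_iterate_pullback_eq hx n
  have hy := h.iterate_mem_Icc hx n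
  rw [h2, abs_div, abs_of_pos hD, div_le_iff₀ hD]
  calc _ ≤ K * (R^[n] x) ^ (m + 3) := hf _ hy
    _ = K * (R^[n] x) ^ m * (R^[n] x) ^ 3 := by ring
    _ ≤ K * (R^[n] x) ^ m * (x ^ 3 * D) := by
      apply mul_le_mul_of_nonneg_left h1
      have := hy.1; positivity
    _ = _ := by ring

theorem summable_sq (_h : ParabolicContraction R c b) :
    Summable fun n : ℕ => (1 / (c * ((n : ℝ) + 1))) ^ 2 := by
  have h1 : Summable fun n : ℕ => 1 / ((n : ℝ) + 1) ^ 2 := by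
    have := (summable_nat_add_iff 1).2 (Real.summable_one_div_nat_pow.2 (one_lt_two))
    simpa using this
  refine (h1.mul_left (1 / c ^ 2)).congr fun n => ?_
  simp only [one_div, mul_inv, inv_pow, mul_pow]

/-- Pullback is linear, so consecutive terms differ by the `n`-th pullback of the defect of `w`.
Fifth order leaves `m = 2` spare powers, just enough for a summable `1 / n ^ 2`. -/
theorem dist_iterate_succ_le (h : ParabolicContraction R c b) {w : ℝ → ℝ} {K : ℝ} (hK : 0 ≤ K)
    (hw : ∀ x ∈ Icc 0 b, |pullback R w x - w x| ≤ K * x ^ 5) {x : ℝ} (hx : x ∈ Icc 0 b) (n : ℕ) :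
    dist ((pullback R)^[n] w x) ((pullback R)^[n + 1] w x) ≤
      K * x ^ 3 * (1 / (c * ((n : ℝ) + 1))) ^ 2 := by
  have h1 : (pullback R)^[n + 1] w x - (pullback R)^[n] w x
      = (pullback R)^[n] (pullback R w - w) x := by
    rw [pullback_iterate_sub, Function.iterate_succ_apply]; rfl
  rw [dist_comm, Real.dist_eq, h1]
  refine (h.abs_iterate_pullback_le (m := 2) hw hK hx n).trans ?_
  rw [mul_right_comm]
  gcongr
  · have := hx.1; positivity
  · exact (h.iterate_mem_Icc hx n).1
  · exact h.iterate_le hx n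

theorem tendsto_pullbackLim (h : ParabolicContraction R c b) {w : ℝ → ℝ} {K : ℝ} (hK : 0 ≤ K)
    (hw : ∀ x ∈ Icc 0 b, |pullback R w x - w x| ≤ K * x ^ 5) {x : ℝ} (hx : x ∈ Icc 0 b) :
    Tendsto (fun n => (pullback R)^[n] w x) atTop (𝓝 (pullbackLim R w x)) :=
  (cauchySeq_of_dist_le_of_summable _ (h.dist_iterate_succ_le hK hw hx)
    (h.summable_sq.mul_left _)).tendsto_limUnder

theorem dist_pullbackLim_le (h : ParabolicContraction R c b) {w : ℝ → ℝ} {K : ℝ} (hK : 0 ≤ K)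
    (hw : ∀ x ∈ Icc 0 b, |pullback R w x - w x| ≤ K * x ^ 5) {x : ℝ} (hx : x ∈ Icc 0 b) (n : ℕ) :
    dist ((pullback R)^[n] w x) (pullbackLim R w x) ≤
      K * x ^ 3 * ∑' m : ℕ, (1 / (c * (((n + m : ℕ) : ℝ) + 1))) ^ 2 := by
  rw [← tsum_mul_left]
  exact dist_le_tsum_of_dist_le_of_tendsto _ (h.dist_iterate_succ_le hK hw hx)
    (h.summable_sq.mul_left _) (h.tendsto_pullbackLim hK hw hx) n

theorem abs_pullbackLim_sub_le (h : ParabolicContraction R c b) {w : ℝ → ℝ} {K : ℝ} (hK : 0 ≤ K)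
    (hw : ∀ x ∈ Icc 0 b, |pullback R w x - w x| ≤ K * x ^ 5) :
    ∃ C, ∀ x ∈ Icc 0 b, |pullbackLim R w x - w x| ≤ C * x ^ 3 := by
  refine ⟨K * ∑' m : ℕ, (1 / (c * (((0 + m : ℕ) : ℝ) + 1))) ^ 2, fun x hx => ?_⟩
  have := h.dist_pullbackLim_le hK hw hx 0
  rw [dist_comm, Real.dist_eq] at this
  refine this.trans_eq (by ring)

theorem pullbackLim_invariant (h : ParabolicContraction R c b) {w : ℝ → ℝ} {K : ℝ} (hK : 0 ≤ K)
    (hw : ∀ x ∈ Icc 0 b, |pullback R w x - w x| ≤ K * x ^ 5) {x : ℝ} (hx : x ∈ Icc 0 b) :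
    pullbackLim R w (R x) = deriv R x * pullbackLim R w x := by
  have h1 := (h.tendsto_pullbackLim hK hw (h.mapsTo_Icc hx)).div_const (deriv R x)
  have h2 := (tendsto_add_atTop_iff_nat 1).2 (h.tendsto_pullbackLim hK hw hx)
  have h3 : (fun n => (pullback R)^[n + 1] w x) =
      fun n => (pullback R)^[n] w (R x) / deriv R x := by
    ext n; rw [Function.iterate_succ_apply']; rfl
  rw [h3] at h2
  have := tendsto_nhds_unique h1 h2
  rw [← this]
  have := (h.deriv_pos hx).ne'
  field_simp

/-- Changing `w` to fourth order does not change the limit. -/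
theorem tendsto_pullbackLim_of_isBigO (h : ParabolicContraction R c b) {v w : ℝ → ℝ} {K : ℝ}
    (hK : 0 ≤ K) (hw : ∀ x ∈ Icc 0 b, |pullback R w x - w x| ≤ K * x ^ 5)
    (hv : (fun x => v x - w x) =O[𝓝 0] fun x => x ^ 4) {x : ℝ} (hx : x ∈ Ioc 0 b) :
    Tendsto (fun n => (pullback R)^[n] v x) atTop (𝓝 (pullbackLim R w x)) := by
  have hx' := Ioc_subset_Icc_self hx
  suffices hs : Tendsto (fun n => (pullback R)^[n] (v - w) x) atTop (𝓝 0) by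
    have := hs.add (h.tendsto_pullbackLim hK hw hx')
    simp only [pullback_iterate_sub, Pi.sub_apply, sub_add_cancel, zero_add] at this
    exact this
  obtain ⟨C, hC⟩ := hv.bound
  have ht := h.tendsto_iterate hx'
  have h0 : Tendsto (fun n => C * R^[n] x * x ^ 3) atTop (𝓝 0) := by
    simpa using (ht.const_mul C).mul_const (x ^ 3)
  refine squeeze_zero_norm' ?_ h0
  filter_upwards [ht.eventually hC] with n hn
  obtain ⟨D, hD, h1, h2⟩ := h.exists_iterate_pullback_eq hx' n
  have hy := h.iterate_mem_Ioc hx n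
  simp only [Real.norm_eq_abs, abs_pow] at hn
  rw [abs_of_pos hy.1] at hn
  rw [h2, Real.norm_eq_abs, abs_div, abs_of_pos hD, div_le_iff₀ hD]
  -- The constant `C` carries no sign; a negative value would contradict the bound `hn`.
  have hC0 : 0 ≤ C * R^[n] x := by
    by_contra hcon
    push Not at hcon
    have h5 : C * R^[n] x ^ 4 < 0 := by
      have := mul_neg_of_neg_of_pos hcon (pow_pos hy.1 3)
      nlinarith
    linarith [abs_nonneg (v (R^[n] x) - w (R^[n] x))]
  calc _ ≤ C * (R^[n] x) ^ 4 := hn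
    _ = C * R^[n] x * (R^[n] x) ^ 3 := by ring
    _ ≤ C * R^[n] x * (x ^ 3 * D) := mul_le_mul_of_nonneg_left h1 hC0
    _ = _ := by ring

/-- Two invariant vector fields with the same nonzero leading coefficient agree. -/
theorem eq_of_invariant (h : ParabolicContraction R c b) {v w : ℝ → ℝ} {a : ℝ} (ha : a ≠ 0)
    (hv : ∀ x ∈ Ioo 0 b, v (R x) = deriv R x * v x)
    (hw : ∀ x ∈ Ioo 0 b, w (R x) = deriv R x * w x)
    (hva : Tendsto (fun x => v x / x ^ 2) (𝓝[>] 0) (𝓝 a))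
    (hwa : Tendsto (fun x => w x / x ^ 2) (𝓝[>] 0) (𝓝 a)) {x : ℝ} (hx : x ∈ Ioo 0 b) :
    v x = w x := by
  -- The ratio of the two fields is constant along orbits, since both are multiplied by the same
  -- derivative. In cross-multiplied form no division by a value of a field is needed; dividing by
  -- `(R^[n] x) ^ 2` and passing to the limit gives `v x * a = w x * a`.
  have key : ∀ n, v x * w (R^[n] x) = w x * v (R^[n] x) := by
    intro n
    induction n with
    | zero => simp [mul_comm]
    | succ n ih =>
      have hy : R^[n] x ∈ Ioo 0 b := h.mapsTo_Ioo.iterate n hx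
      rw [Function.iterate_succ_apply', hv _ hy, hw _ hy, mul_left_comm, ih, mul_left_comm]
  have ht : Tendsto (fun n => R^[n] x) atTop (𝓝[>] 0) :=
    tendsto_nhdsWithin_iff.2 ⟨h.tendsto_iterate (Ioo_subset_Icc_self hx),
      Eventually.of_forall fun n => (h.mapsTo_Ioo.iterate n hx).1⟩
  have h1 := (hwa.comp ht).const_mul (v x)
  have h2 := (hva.comp ht).const_mul (w x)
  have h3 : (fun n => v x * ((fun x => w x / x ^ 2) ∘ fun n => R^[n] x) n) =
      fun n => w x * ((fun x => v x / x ^ 2) ∘ fun n => R^[n] x) n := by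
    ext n
    simp only [Function.comp_apply, ← mul_div_assoc, key n]
  rw [h3] at h1
  exact mul_right_cancel₀ ha (tendsto_nhds_unique h1 h2)

/-- A zero propagates along its orbit to `0`, which would make the quadratic coefficient vanish. -/
theorem ne_zero_of_invariant (h : ParabolicContraction R c b) {w : ℝ → ℝ} {a : ℝ} (ha : a ≠ 0)
    (hw : ∀ x ∈ Ioo 0 b, w (R x) = deriv R x * w x)
    (hwa : Tendsto (fun x => w x / x ^ 2) (𝓝[>] 0) (𝓝 a)) {x : ℝ} (hx : x ∈ Ioo 0 b) :
    w x ≠ 0 := by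
  intro h0
  have key : ∀ n, w (R^[n] x) = 0 := by
    intro n
    induction n with
    | zero => exact h0
    | succ n ih =>
      rw [Function.iterate_succ_apply', hw _ (h.mapsTo_Ioo.iterate n hx), ih, mul_zero]
  have ht : Tendsto (fun n => R^[n] x) atTop (𝓝[>] 0) :=
    tendsto_nhdsWithin_iff.2 ⟨h.tendsto_iterate (Ioo_subset_Icc_self hx),
      Eventually.of_forall fun n => (h.mapsTo_Ioo.iterate n hx).1⟩
  have h1 := hwa.comp ht
  simp only [Function.comp_def, key, zero_div] at h1
  exact ha (tendsto_nhds_unique h1 tendsto_const_nhds)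

end ParabolicContraction

/-! ### Continuous dependence of the pullback limit on the map. -/

/-- Uniform convergence of the maps and their derivatives gives uniform convergence of the iterated
pullbacks. -/
theorem tendstoUniformlyOn_iterate_pullback {ι : Type*} {l : Filter ι} {Q : ι → ℝ → ℝ}
    {R : ℝ → ℝ} {c b : ℝ} (hQ : ∀ i, ParabolicContraction (Q i) c b)
    (hR : ParabolicContraction R c b) (hR' : ContinuousOn (deriv R) (Icc 0 b))
    (h0 : TendstoUniformlyOn Q R l (Icc 0 b))
    (h1 : TendstoUniformlyOn (fun i => deriv (Q i)) (deriv R) l (Icc 0 b))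
    {v : ι → ℝ → ℝ} {w : ℝ → ℝ} (hw : ContinuousOn w (Icc 0 b))
    (hvw : TendstoUniformlyOn v w l (Icc 0 b)) (n : ℕ) :
    ContinuousOn ((pullback R)^[n] w) (Icc 0 b) ∧
    TendstoUniformlyOn (fun i => (pullback (Q i))^[n] (v i)) ((pullback R)^[n] w) l (Icc 0 b) := by
  induction n with
  | zero => exact ⟨hw, hvw⟩
  | succ n ih =>
    obtain ⟨hc, hu⟩ := ih
    simp only [Function.iterate_succ_apply']
    set g := (pullback R)^[n] w
    have hRc : ContinuousOn R (Icc 0 b) := fun x hx =>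
      (hR.hasDerivAt hx).continuousAt.continuousWithinAt
    refine ⟨(hc.comp hRc hR.mapsTo_Icc).div hR' fun x hx => (hR.deriv_pos hx).ne', ?_⟩
    obtain ⟨M, hM⟩ := isCompact_Icc.exists_bound_of_continuousOn hc
    have hM0 : 0 ≤ M := (norm_nonneg _).trans (hM 0 ⟨le_rfl, hR.b_pos.le⟩)
    have huc := isCompact_Icc.uniformContinuousOn_of_continuous hc
    rw [Metric.uniformContinuousOn_iff] at huc
    rw [Metric.tendstoUniformlyOn_iff] at h0 h1 hu ⊢
    intro ε hε
    obtain ⟨η, hη, hηg⟩ := huc (ε / 8) (by positivity)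
    filter_upwards [h0 η hη, h1 (ε / (8 * (M + 1))) (by positivity), hu (ε / 8) (by positivity)]
      with i hi0 hi1 hi2 x hx
    have e1 := hηg _ (hR.mapsTo_Icc hx) _ ((hQ i).mapsTo_Icc hx) (hi0 x hx)
    have e2 := hi2 _ ((hQ i).mapsTo_Icc hx)
    have e3 := hi1 x hx
    have d1 := hR.half_le x hx
    have d2 := (hQ i).half_le x hx
    have hgM := hM _ (hR.mapsTo_Icc hx)
    simp only [pullback]
    set α := g (R x)
    set β := (pullback (Q i))^[n] (v i) (Q i x)
    set d := deriv R x
    set e := deriv (Q i) x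
    have e12 : |α - β| < ε / 4 := by
      have := dist_triangle α (g (Q i x)) β
      rw [Real.dist_eq] at this
      linarith
    rw [Real.dist_eq] at e3 ⊢
    rw [Real.norm_eq_abs] at hgM
    -- The error splits into that of the numerator and that of the denominator; both derivatives are
    -- at least `1 / 2`.
    have h5 : α / d - β / e = (α - β) / e + α * (e - d) / (d * e) := by
      have : d ≠ 0 := by linarith
      have : e ≠ 0 := by linarith
      field_simp
      ring
    have h6 : |(α - β) / e| < ε / 2 := by
      rw [abs_div, abs_of_pos (by linarith : 0 < e), div_lt_iff₀ (by linarith)]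
      nlinarith
    have h7 : |α * (e - d) / (d * e)| ≤ ε / 2 := by
      have hde : 1 / 4 ≤ d * e := by nlinarith
      rw [abs_div, abs_of_pos (by linarith : 0 < d * e), div_le_iff₀ (by linarith), abs_mul,
        abs_sub_comm]
      have : |α| * |d - e| ≤ (M + 1) * (ε / (8 * (M + 1))) :=
        mul_le_mul (by linarith) e3.le (abs_nonneg _) (by linarith)
      have h8 : (M + 1) * (ε / (8 * (M + 1))) = ε / 8 := by
        field_simp
      nlinarith
    rw [h5]
    exact (abs_add_le _ _).trans_lt (by linarith)

/-- The tail bound `τ n` involves only `K`, `b` and `c`, which are common to all the maps. Fixing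
one `n` with small tail reduces the claim to a finite pullback. -/
theorem tendstoUniformlyOn_pullbackLim {ι : Type*} {l : Filter ι} {Q : ι → ℝ → ℝ}
    {R : ℝ → ℝ} {c b : ℝ} (hQ : ∀ i, ParabolicContraction (Q i) c b)
    (hR : ParabolicContraction R c b) (hR' : ContinuousOn (deriv R) (Icc 0 b))
    (h0 : TendstoUniformlyOn Q R l (Icc 0 b))
    (h1 : TendstoUniformlyOn (fun i => deriv (Q i)) (deriv R) l (Icc 0 b))
    {v : ι → ℝ → ℝ} {w : ℝ → ℝ} (hw : ContinuousOn w (Icc 0 b))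
    (hvw : TendstoUniformlyOn v w l (Icc 0 b)) {K : ℝ} (hK : 0 ≤ K)
    (hvK : ∀ i, ∀ x ∈ Icc 0 b, |pullback (Q i) (v i) x - v i x| ≤ K * x ^ 5)
    (hwK : ∀ x ∈ Icc 0 b, |pullback R w x - w x| ≤ K * x ^ 5) :
    TendstoUniformlyOn (fun i => pullbackLim (Q i) (v i)) (pullbackLim R w) l (Icc 0 b) := by
  set τ : ℕ → ℝ := fun n => K * b ^ 3 * ∑' m : ℕ, (1 / (c * (((n + m : ℕ) : ℝ) + 1))) ^ 2
  have hτ : Tendsto τ atTop (𝓝 0) := by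
    have := (tendsto_sum_nat_add fun n : ℕ => (1 / (c * ((n : ℝ) + 1))) ^ 2).const_mul (K * b ^ 3)
    simp only [mul_zero] at this
    refine this.congr fun n => ?_
    simp only [τ, add_comm]
  have hle : ∀ {S z : ℝ → ℝ}, ParabolicContraction S c b →
      (∀ x ∈ Icc 0 b, |pullback S z x - z x| ≤ K * x ^ 5) → ∀ n, ∀ x ∈ Icc 0 b,
      dist ((pullback S)^[n] z x) (pullbackLim S z x) ≤ τ n := by
    intro S z hS hz n x hx
    refine (hS.dist_pullbackLim_le hK hz hx n).trans ?_
    have : 0 ≤ ∑' m : ℕ, (1 / (c * (((n + m : ℕ) : ℝ) + 1))) ^ 2 := tsum_nonneg fun _ => sq_nonneg _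
    exact mul_le_mul_of_nonneg_right
      (mul_le_mul_of_nonneg_left (pow_le_pow_left₀ hx.1 hx.2 3) hK) this
  rw [Metric.tendstoUniformlyOn_iff]
  intro ε hε
  obtain ⟨n, hn⟩ := (hτ.eventually (gt_mem_nhds (show 0 < ε / 3 by positivity))).exists
  have hu := (tendstoUniformlyOn_iterate_pullback hQ hR hR' h0 h1 hw hvw n).2
  rw [Metric.tendstoUniformlyOn_iff] at hu
  filter_upwards [hu (ε / 3) (by positivity)] with i hi x hx
  have e1 := hle hR hwK n x hx
  have e2 := hle (hQ i) (hvK i) n x hx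
  have e3 := hi x hx
  have := dist_triangle4 (pullbackLim R w x) ((pullback R)^[n] w x)
    ((pullback (Q i))^[n] (v i) x) (pullbackLim (Q i) (v i) x)
  rw [dist_comm] at e1
  linarith

/-! ### Order of vanishing and Taylor estimates. -/

theorem ContDiffAt.iteratedDeriv_of_add {f : ℝ → ℝ} {x : ℝ} (m j : ℕ)
    (hf : ContDiffAt ℝ ((m + j : ℕ) : WithTop ℕ∞) f x) :
    ContDiffAt ℝ m (iteratedDeriv j f) x := by
  induction j generalizing f with
  | zero => simpa using hf
  | succ j ih =>
    rw [iteratedDeriv_succ']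
    refine ih (hf.derivWithin ?_)
    push_cast
    rw [add_assoc]

theorem ContDiffAt.hasDerivAt_iteratedDeriv {f : ℝ → ℝ} {x : ℝ} {j : ℕ}
    (hf : ContDiffAt ℝ ((j + 1 : ℕ) : WithTop ℕ∞) f x) :
    HasDerivAt (iteratedDeriv j f) (iteratedDeriv (j + 1) f x) x := by
  rw [iteratedDeriv_succ]
  rw [add_comm] at hf
  exact ((hf.iteratedDeriv_of_add 1 j).differentiableAt (by simp)).hasDerivAt

theorem ContDiffAt.nat_of_infty {f : ℝ → ℝ} {x : ℝ} (hf : ContDiffAt ℝ ∞ f x) (n : ℕ) :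
    ContDiffAt ℝ n f x := hf.of_le (by exact_mod_cast le_top)

theorem ContDiffAt.deriv_infty {f : ℝ → ℝ} {x : ℝ} (hf : ContDiffAt ℝ ∞ f x) :
    ContDiffAt ℝ ∞ (deriv f) x := hf.derivWithin le_rfl

/-- If the derivatives of order `< N` vanish at `0` and the one of order `N` is bounded, then the
derivative of order `N - i` is bounded by a multiple of `|x| ^ i`. -/
theorem abs_le_of_deriv_tower {S : Set ℝ} (hS : S.OrdConnected) (h0S : (0 : ℝ) ∈ S)
    {F : ℕ → ℝ → ℝ} {N : ℕ} {C : ℝ}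
    (hF : ∀ j < N, ∀ x ∈ S, HasDerivAt (F j) (F (j + 1) x) x) (h0 : ∀ j < N, F j 0 = 0)
    (hC : ∀ x ∈ S, |F N x| ≤ C) (i : ℕ) (hi : i ≤ N) :
    ∀ x ∈ S, |F (N - i) x| ≤ C * |x| ^ i := by
  induction i with
  | zero => simpa using hC
  | succ i ih =>
    intro x hx
    have hsub : uIcc 0 x ⊆ S := hS.uIcc_subset h0S hx
    have hC0 : 0 ≤ C := (abs_nonneg _).trans (hC 0 h0S)
    have e : N - (i + 1) + 1 = N - i := by omega
    have h1 := (convex_uIcc (0 : ℝ) x).norm_image_sub_le_of_norm_hasDerivWithin_le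
      (f := F (N - (i + 1))) (f' := F (N - i)) (C := C * |x| ^ i)
      (fun y hy => by
        have := hF (N - (i + 1)) (by omega) y (hsub hy)
        rw [e] at this
        exact this.hasDerivWithinAt)
      (fun y hy => (ih (by omega) y (hsub hy)).trans (by
        have : |y| ≤ |x| := by simpa using abs_sub_left_of_mem_uIcc hy
        gcongr)) left_mem_uIcc right_mem_uIcc
    rw [h0 _ (by omega), sub_zero, sub_zero, Real.norm_eq_abs, Real.norm_eq_abs] at h1
    rw [pow_succ, ← mul_assoc]
    exact h1

theorem isBigO_pow_of_iteratedDeriv_eq_zero {f : ℝ → ℝ} (hf : ContDiffAt ℝ ∞ f 0) {N : ℕ}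
    (h0 : ∀ j < N, iteratedDeriv j f 0 = 0) : f =O[𝓝 0] fun x => x ^ N := by
  have h1 := (hf.nat_of_infty (N + 1)).eventually (by simp)
  have hc : ContinuousAt (iteratedDeriv N f) 0 :=
    (hf.nat_of_infty (N + 1)).hasDerivAt_iteratedDeriv.continuousAt
  have h2 : ∀ᶠ x in 𝓝 0, |iteratedDeriv N f x| < |iteratedDeriv N f 0| + 1 :=
    hc.abs.eventually (gt_mem_nhds (by linarith))
  obtain ⟨r, hr, hb⟩ := Metric.eventually_nhds_iff_ball.1 (h1.and h2)
  refine Asymptotics.IsBigO.of_bound (|iteratedDeriv N f 0| + 1) ?_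
  filter_upwards [Metric.ball_mem_nhds 0 hr] with x hx
  have hS : (Metric.ball (0 : ℝ) r).OrdConnected := by
    rw [Real.ball_eq_Ioo]; exact ordConnected_Ioo
  have := abs_le_of_deriv_tower hS (Metric.mem_ball_self hr) (F := fun j => iteratedDeriv j f)
    (fun j hj y hy => ((hb y hy).1.of_le (by exact_mod_cast (by omega))).hasDerivAt_iteratedDeriv)
    h0 (fun y hy => (hb y hy).2.le) N le_rfl x hx
  simpa using this

theorem contDiffAt_const_mul_pow (a : ℝ) (N : ℕ) (x : ℝ) :
    ContDiffAt ℝ ∞ (fun x : ℝ => a * x ^ N) x := by fun_prop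

theorem isBigO_sub_leading {f : ℝ → ℝ} (hf : ContDiffAt ℝ ∞ f 0) {N : ℕ}
    (h0 : ∀ j < N, iteratedDeriv j f 0 = 0) :
    (fun x => f x - iteratedDeriv N f 0 / N.factorial * x ^ N) =O[𝓝 0] fun x => x ^ (N + 1) := by
  set a := iteratedDeriv N f 0 / N.factorial with ha
  have hp := contDiffAt_const_mul_pow a N 0
  refine isBigO_pow_of_iteratedDeriv_eq_zero (f := f - fun x => a * x ^ N) (hf.sub hp)
    fun j hj => ?_
  rw [iteratedDeriv_sub (hf.nat_of_infty j) (hp.nat_of_infty j),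
    iteratedDeriv_const_mul_field, iteratedDeriv_fun_pow_zero]
  split_ifs with h
  · subst h
    rw [ha, div_mul_cancel₀ _ (by positivity), sub_self]
  · rw [h0 j (by omega), Nat.cast_zero, mul_zero, sub_zero]

theorem pow_succ_isBigO_pow (N : ℕ) :
    (fun x : ℝ => x ^ (N + 1)) =O[𝓝 0] fun x : ℝ => x ^ N :=
  (Asymptotics.isLittleO_pow_pow (Nat.lt_succ_self N)).isBigO

/-- The first nonvanishing Taylor monomial `x ^ j` with `j < N` would be little-o of itself. -/
theorem iteratedDeriv_eq_zero_of_isBigO {f : ℝ → ℝ} (hf : ContDiffAt ℝ ∞ f 0) {N : ℕ}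
    (hO : f =O[𝓝 0] fun x => x ^ N) : ∀ j < N, iteratedDeriv j f 0 = 0 := by
  induction N with
  | zero => intro j hj; omega
  | succ N ih =>
    have h1 := ih (hO.trans (pow_succ_isBigO_pow N))
    intro j hj
    rcases Nat.lt_succ_iff_lt_or_eq.1 hj with h | rfl
    · exact h1 j h
    have h2 := hO.sub (isBigO_sub_leading hf h1)
    simp only [sub_sub_cancel] at h2
    have h3 : (fun x : ℝ => iteratedDeriv j f 0 / j.factorial * x ^ j) =o[𝓝 0] fun x => x ^ j :=
      h2.trans_isLittleO (Asymptotics.isLittleO_pow_pow (Nat.lt_succ_self j))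
    by_contra hne
    have ha : iteratedDeriv j f 0 / j.factorial ≠ 0 := by positivity
    have h4 := (Asymptotics.isLittleO_const_mul_left_iff ha).1 h3
    have h5 := (Asymptotics.isLittleO_irrefl' (l := 𝓝[≠] (0 : ℝ)) (f' := fun x : ℝ => x ^ j) (by
      apply Eventually.frequently
      filter_upwards [self_mem_nhdsWithin] with x hx
      simpa using pow_ne_zero j hx))
    exact h5 (h4.mono nhdsWithin_le_nhds)

theorem exists_isBigO_sub_leading {f : ℝ → ℝ} (hf : ContDiffAt ℝ ∞ f 0) {N : ℕ}
    (hO : f =O[𝓝 0] fun x => x ^ N) :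
    ∃ a : ℝ, (fun x => f x - a * x ^ N) =O[𝓝 0] fun x => x ^ (N + 1) :=
  ⟨_, isBigO_sub_leading hf (iteratedDeriv_eq_zero_of_isBigO hf hO)⟩

/-- A smooth function that is `O(x ^ N)` at `0` has its derivatives bounded accordingly. -/
theorem exists_abs_iteratedDeriv_le {f : ℝ → ℝ} {b : ℝ} (hb : 0 < b)
    (hf : ∀ x ∈ Icc 0 b, ContDiffAt ℝ ∞ f x) {N : ℕ} (hO : f =O[𝓝 0] fun x => x ^ N) :
    ∃ C, 0 ≤ C ∧ ∀ j ≤ N, ∀ x ∈ Icc 0 b, |iteratedDeriv j f x| ≤ C * x ^ (N - j) := by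
  have h0 : (0 : ℝ) ∈ Icc 0 b := ⟨le_rfl, hb.le⟩
  have hc : ContinuousOn (iteratedDeriv N f) (Icc 0 b) := fun x hx =>
    ((hf x hx).nat_of_infty (N + 1)).hasDerivAt_iteratedDeriv.continuousAt.continuousWithinAt
  obtain ⟨C, hC⟩ := isCompact_Icc.exists_bound_of_continuousOn hc
  refine ⟨C, (norm_nonneg _).trans (hC 0 h0), fun j hj x hx => ?_⟩
  have := abs_le_of_deriv_tower (F := fun j => iteratedDeriv j f) ordConnected_Icc h0
    (fun j _ y hy => ((hf y hy).nat_of_infty (j + 1)).hasDerivAt_iteratedDeriv)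
    (iteratedDeriv_eq_zero_of_isBigO (hf 0 h0) hO) hC (N - j) (by omega) x hx
  rwa [abs_of_nonneg hx.1, Nat.sub_sub_self hj] at this

/-! ### Formal solution of the invariance equation. -/

section Formal

variable {Q : ℝ → ℝ} {A : ℝ}

theorem isBigO_id_of_expansion
    (h : (fun x => Q x - (x - A * x ^ 2)) =O[𝓝 0] fun x => x ^ 3) :
    Q =O[𝓝 0] fun x => x := by
  have h1 : (fun x : ℝ => x ^ 3) =O[𝓝 0] fun x : ℝ => x := by
    simpa using (pow_succ_isBigO_pow 2).trans (pow_succ_isBigO_pow 1)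
  have h2 : (fun x : ℝ => x - A * x ^ 2) =O[𝓝 0] fun x : ℝ => x := by
    refine (Asymptotics.isBigO_refl _ _).sub ?_
    simpa using (pow_succ_isBigO_pow 1).const_mul_left A
  simpa using (h.trans h1).add h2

theorem isBigO_pow_sub (h : (fun x => Q x - (x - A * x ^ 2)) =O[𝓝 0] fun x => x ^ 3) (m : ℕ) :
    (fun x => Q x ^ m - (x ^ m - m * A * x ^ (m + 1))) =O[𝓝 0] fun x => x ^ (m + 2) := by
  induction m with
  | zero => simpa using Asymptotics.isBigO_zero _ _
  | succ m ih =>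
    have e : (fun x => Q x ^ (m + 1) - (x ^ (m + 1) - (m + 1 : ℕ) * A * x ^ (m + 1 + 1))) =
      fun x => (Q x ^ m - (x ^ m - m * A * x ^ (m + 1))) * Q x +
        (x ^ m - m * A * x ^ (m + 1)) * (Q x - (x - A * x ^ 2)) + m * A ^ 2 * x ^ (m + 3) := by
      ext x; push_cast; ring
    rw [e]
    refine (Asymptotics.IsBigO.add ?_ ?_).add
      ((Asymptotics.isBigO_refl (fun x : ℝ => x ^ (m + 3)) _).const_mul_left _)
    · exact (ih.mul (isBigO_id_of_expansion h)).congr_right fun x => by ring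
    · have h2 : (fun x : ℝ => x ^ m - m * A * x ^ (m + 1)) =O[𝓝 0] fun x : ℝ => x ^ m :=
        (Asymptotics.isBigO_refl _ _).sub ((pow_succ_isBigO_pow m).const_mul_left _)
      exact (h2.mul h).congr_right fun x => by ring

/-- The formal invariant vector field, to any order. -/
theorem exists_formal_invariant (hQ : ContDiffAt ℝ ∞ Q 0) (hA : A ≠ 0)
    (h : (fun x => Q x - (x - A * x ^ 2)) =O[𝓝 0] fun x => x ^ 3)
    (h' : (fun x => deriv Q x - (1 - 2 * A * x)) =O[𝓝 0] fun x => x ^ 2)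
    {w₀ : ℝ → ℝ} (hw₀ : ContDiff ℝ ∞ w₀)
    (hd : (fun x => w₀ (Q x) - deriv Q x * w₀ x) =O[𝓝 0] fun x => x ^ 5) (N : ℕ) :
    ∃ w : ℝ → ℝ, ContDiff ℝ ∞ w ∧ (fun x => w x - w₀ x) =O[𝓝 0] (fun x => x ^ 4) ∧
      (fun x => w (Q x) - deriv Q x * w x) =O[𝓝 0] fun x => x ^ (N + 5) := by
  induction N with
  | zero => exact ⟨w₀, hw₀, by simpa using Asymptotics.isBigO_zero _ _, hd⟩
  | succ N ih =>
    obtain ⟨w, hw, h1, h2⟩ := ih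
    have hs : ContDiffAt ℝ ∞ (fun x => w (Q x) - deriv Q x * w x) 0 :=
      (hw.contDiffAt.comp 0 hQ).sub (hQ.deriv_infty.mul hw.contDiffAt)
    obtain ⟨a, ha⟩ := exists_isBigO_sub_leading hs h2
    have hN : ((N : ℝ) + 2) * A ≠ 0 := mul_ne_zero (by positivity) hA
    -- Adding `t * x ^ m` changes the defect by `t * (Q ^ m - Q' * x ^ m)`, with leading term `-t *
    -- (m - 2) * A * x ^ (m + 1)`. For `m = N + 4` this value of `t` cancels the leading term `a * x
    -- ^ (N + 5)`.
    refine ⟨fun x => w x + a / ((N + 2) * A) * x ^ (N + 4), by fun_prop, ?_, ?_⟩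
    · have : (fun x : ℝ => x ^ (N + 4)) =O[𝓝 0] fun x : ℝ => x ^ 4 := by
        clear * -
        induction N with
        | zero => simpa using Asymptotics.isBigO_refl _ _
        | succ N ih =>
          have := pow_succ_isBigO_pow (N + 4)
          rw [show N + 4 + 1 = N + 1 + 4 by ring] at this
          exact this.trans ih
      exact (h1.add (this.const_mul_left (a / ((N + 2) * A)))).congr_left fun x => by ring
    · have e : (fun x => (w (Q x) + a / ((N + 2) * A) * Q x ^ (N + 4)) -
            deriv Q x * (w x + a / ((N + 2) * A) * x ^ (N + 4))) =
          fun x => (w (Q x) - deriv Q x * w x - a * x ^ (N + 5)) +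
          a / ((N + 2) * A) * ((Q x ^ (N + 4) - (x ^ (N + 4) - ((N + 4 : ℕ) : ℝ) * A *
            x ^ (N + 4 + 1))) - (deriv Q x - (1 - 2 * A * x)) * x ^ (N + 4)) := by
        ext x
        push_cast
        field_simp
        ring
      rw [e]
      refine ha.add (Asymptotics.IsBigO.const_mul_left ((isBigO_pow_sub h (N + 4)).sub ?_) _)
      exact (h'.mul (Asymptotics.isBigO_refl (fun x : ℝ => x ^ (N + 4)) _)).congr_right
        fun x => by ring

end Formal

/-! ### Derivatives of iterated pullbacks and smoothness of the limit. -/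

/-- Coefficients of the derivatives of a pullback: `(w ∘ R / R')^(j) = ∑ i ≤ j, cᵢⱼ * w^(i) ∘ R`. -/
noncomputable def pullbackCoeff (R : ℝ → ℝ) : ℕ → ℕ → ℝ → ℝ
  | 0, 0 => fun x => (deriv R x)⁻¹
  | 0, _ + 1 => 0
  | j + 1, 0 => deriv (pullbackCoeff R j 0)
  | j + 1, i + 1 => fun x => deriv (pullbackCoeff R j (i + 1)) x + deriv R x * pullbackCoeff R j i x

/-- The pullback of a sequence of successive derivatives. -/
noncomputable def pullbackJet (R : ℝ → ℝ) (F : ℕ → ℝ → ℝ) (j : ℕ) (x : ℝ) : ℝ :=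
  ∑ i ∈ Finset.range (j + 1), pullbackCoeff R j i x * F i (R x)

theorem pullbackCoeff_eq_zero (R : ℝ → ℝ) {j i : ℕ} (h : j < i) : pullbackCoeff R j i = 0 := by
  induction j generalizing i with
  | zero => obtain ⟨i, rfl⟩ := Nat.exists_eq_succ_of_ne_zero h.ne'; rfl
  | succ j ih =>
    obtain ⟨i, rfl⟩ := Nat.exists_eq_succ_of_ne_zero (Nat.ne_zero_of_lt h)
    ext x
    simp only [pullbackCoeff]
    rw [ih (by omega), ih (by omega)]
    simp

/-- The exponent is `j - 1`; the quotient form covers `j = 0`, where the coefficient is the inverse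
of the derivative. -/
theorem pullbackCoeff_self (R : ℝ → ℝ) (j : ℕ) (x : ℝ) :
    pullbackCoeff R j j x = deriv R x ^ j / deriv R x := by
  induction j with
  | zero => simp [pullbackCoeff]
  | succ j ih =>
    simp only [pullbackCoeff]
    rw [ih, pullbackCoeff_eq_zero R (Nat.lt_succ_self j)]
    simp
    ring

theorem pullbackJet_zero (R : ℝ → ℝ) (F : ℕ → ℝ → ℝ) : pullbackJet R F 0 = pullback R (F 0) := by
  ext x
  simp [pullbackJet, pullbackCoeff, pullback, div_eq_inv_mul]

theorem iterate_pullbackJet_zero (R : ℝ → ℝ) (F : ℕ → ℝ → ℝ) (n : ℕ) :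
    (pullbackJet R)^[n] F 0 = (pullback R)^[n] (F 0) := by
  induction n with
  | zero => rfl
  | succ n ih => rw [Function.iterate_succ_apply', Function.iterate_succ_apply', pullbackJet_zero, ih]

namespace ParabolicContraction

variable {R : ℝ → ℝ} {c b : ℝ}

theorem contDiffAt_pullbackCoeff (h : ParabolicContraction R c b) {x : ℝ} (hx : x ∈ Icc 0 b)
    (hR : ContDiffAt ℝ ∞ R x) (j i : ℕ) : ContDiffAt ℝ ∞ (pullbackCoeff R j i) x := by
  induction j generalizing i with
  | zero =>
    cases i with
    | zero => exact hR.deriv_infty.inv (h.deriv_pos hx).ne'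
    | succ i => exact contDiffAt_const
  | succ j ih =>
    cases i with
    | zero => exact (ih 0).deriv_infty
    | succ i => exact (ih (i + 1)).deriv_infty.add (hR.deriv_infty.mul (ih i))

theorem hasDerivAt_pullbackJet (h : ParabolicContraction R c b)
    (hR : ∀ x ∈ Icc 0 b, ContDiffAt ℝ ∞ R x) {F : ℕ → ℝ → ℝ}
    (hF : ∀ j, ∀ x ∈ Ioo 0 b, HasDerivAt (F j) (F (j + 1) x) x) (j : ℕ) {x : ℝ}
    (hx : x ∈ Ioo 0 b) : HasDerivAt (pullbackJet R F j) (pullbackJet R F (j + 1) x) x := by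
  have hx' := Ioo_subset_Icc_self hx
  have h1 : HasDerivAt (pullbackJet R F j) (∑ i ∈ Finset.range (j + 1),
      (deriv (pullbackCoeff R j i) x * F i (R x) +
        pullbackCoeff R j i x * (F (i + 1) (R x) * deriv R x))) x := by
    refine HasDerivAt.fun_sum fun i _ => ?_
    have hc : HasDerivAt (pullbackCoeff R j i) (deriv (pullbackCoeff R j i) x) x :=
      ((h.contDiffAt_pullbackCoeff hx' (hR x hx') j i).differentiableAt (by simp)).hasDerivAt
    exact hc.mul ((hF i _ (h.mapsTo_Ioo hx)).comp x (h.hasDerivAt hx'))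
  convert h1 using 1
  rw [pullbackJet, Finset.sum_range_succ', Finset.sum_add_distrib]
  simp only [pullbackCoeff, add_mul, Finset.sum_add_distrib]
  -- Shifting the index introduces the coefficient with `i = j + 1`, which vanishes.
  have h2 : ∑ i ∈ Finset.range (j + 1), deriv (pullbackCoeff R j i) x * F i (R x) =
      ∑ i ∈ Finset.range (j + 1), deriv (pullbackCoeff R j (i + 1)) x * F (i + 1) (R x) +
        deriv (pullbackCoeff R j 0) x * F 0 (R x) := by
    rw [← Finset.sum_range_succ' (fun i => deriv (pullbackCoeff R j i) x * F i (R x)) (j + 1),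
      Finset.sum_range_succ _ (j + 1), pullbackCoeff_eq_zero R (Nat.lt_succ_self j)]
    simp
  rw [h2, add_right_comm]
  congr 1
  refine Finset.sum_congr rfl fun i _ => by ring

theorem hasDerivAt_iterate_pullbackJet (h : ParabolicContraction R c b)
    (hR : ∀ x ∈ Icc 0 b, ContDiffAt ℝ ∞ R x) {F : ℕ → ℝ → ℝ}
    (hF : ∀ j, ∀ x ∈ Ioo 0 b, HasDerivAt (F j) (F (j + 1) x) x) (n : ℕ) :
    ∀ j, ∀ x ∈ Ioo 0 b,
      HasDerivAt ((pullbackJet R)^[n] F j) ((pullbackJet R)^[n] F (j + 1) x) x := by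
  induction n with
  | zero => exact hF
  | succ n ih =>
    intro j x hx
    rw [Function.iterate_succ_apply']
    exact h.hasDerivAt_pullbackJet hR ih j hx

theorem map_le_mul (h : ParabolicContraction R c b) {x : ℝ} (hx : x ∈ Icc 0 b) :
    R x ≤ (1 - c * x) * x := (h.le x hx).trans_eq (by ring)

theorem one_sub_mem (h : ParabolicContraction R c b) {x : ℝ} (hx : x ∈ Ioc 0 b) :
    0 ≤ 1 - c * x := by
  have := (h.pos x hx).trans_le (h.map_le_mul (Ioc_subset_Icc_self hx))
  exact (pos_of_mul_pos_left this hx.1.le).le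

/-- The diagonal coefficients contract the weight `x ^ q`. -/
theorem pullbackCoeff_self_mul_le (h : ParabolicContraction R c b) {x : ℝ} (hx : x ∈ Ioc 0 b)
    (j : ℕ) {q : ℕ} (hq : 4 ≤ q) :
    pullbackCoeff R j j x * R x ^ q ≤ x ^ q * (1 - c * x) := by
  have hx' := Ioc_subset_Icc_self hx
  have hd := h.deriv_pos hx'
  have hR0 := h.pos x hx
  have h1 : deriv R x ^ j / deriv R x ≤ 1 / deriv R x := by
    gcongr
    exact pow_le_one₀ hd.le (h.le_one x hx')
  -- Three powers of `R x` absorb the division by `R' x`, one yields the gain `1 - c * x`, and the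
  -- rest are bounded by powers of `x`.
  obtain ⟨p, rfl⟩ : ∃ p, q = p + 1 + 3 := ⟨q - 4, by omega⟩
  rw [pullbackCoeff_self]
  calc _ ≤ 1 / deriv R x * R x ^ (p + 1 + 3) := by gcongr
    _ = R x ^ p * R x * (R x ^ 3 / deriv R x) := by ring
    _ ≤ x ^ p * ((1 - c * x) * x) * x ^ 3 := by
      have := h.one_sub_mem hx
      have h3 := hx.1
      gcongr
      · exact h.map_le hx'
      · exact h.map_le_mul hx'
      · rw [div_le_iff₀ hd]; exact h.cube_le x hx'
    _ = _ := by ring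

theorem pullbackCoeff_self_nonneg (h : ParabolicContraction R c b) {x : ℝ} (hx : x ∈ Icc 0 b)
    (j : ℕ) : 0 ≤ pullbackCoeff R j j x := by
  rw [pullbackCoeff_self]
  have := h.deriv_pos hx
  positivity

/-- The derivatives of the pullbacks of a flat function decay quadratically. -/
theorem exists_abs_iterate_pullbackJet_le (h : ParabolicContraction R c b)
    (hR : ∀ x ∈ Icc 0 b, ContDiffAt ℝ ∞ R x) {F : ℕ → ℝ → ℝ} {k : ℕ} {C : ℝ} (hC : 0 ≤ C)
    (hF : ∀ j ≤ k, ∀ x ∈ Icc 0 b, |F j x| ≤ C * x ^ (k + 6 - j)) (j : ℕ) (hj : j ≤ k) :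
    ∃ K, 0 ≤ K ∧ ∀ n, ∀ x ∈ Ioo 0 b,
      |(pullbackJet R)^[n] F j x| ≤ K * (R^[n] x) ^ 2 * x ^ (k + 4 - j) := by
  induction j using Nat.strong_induction_on with
  | _ j ih =>
  have hc := h.c_pos
  choose! K hK0 hK using fun i (hi : i < j) => ih i hi (by omega)
  have hbd : ∀ i, ∃ B, 0 ≤ B ∧ ∀ x ∈ Icc 0 b, |pullbackCoeff R j i x| ≤ B := by
    intro i
    obtain ⟨B, hB⟩ := isCompact_Icc.exists_bound_of_continuousOn
      (f := pullbackCoeff R j i) (s := Icc 0 b) fun x hx =>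
        (h.contDiffAt_pullbackCoeff hx (hR x hx) j i).continuousAt.continuousWithinAt
    exact ⟨B, (norm_nonneg _).trans (hB 0 ⟨le_rfl, h.b_pos.le⟩), hB⟩
  choose B hB0 hB using hbd
  -- Off-diagonal terms involve only lower derivatives, whose weights have at least one more power
  -- of `x`; together they contribute at most `S * x` times the weight.
  set S := ∑ i ∈ Finset.range j, B i * K i * b ^ (j - i - 1) with hS
  have hb := h.b_pos.le
  have hS0 : 0 ≤ S := Finset.sum_nonneg fun i hi =>
    mul_nonneg (mul_nonneg (hB0 i) (hK0 i (Finset.mem_range.1 hi))) (by positivity)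
  -- The diagonal term loses a fraction `c * x`, and `(S / c) * (1 - c * x) + S * x = S / c`: the
  -- constant reproduces itself under the induction on `n`.
  refine ⟨C + S / c, by positivity, fun n => ?_⟩
  induction n with
  | zero =>
    intro x hx
    refine (hF j hj x (Ioo_subset_Icc_self hx)).trans ?_
    have hx0 := hx.1
    rw [Function.iterate_zero, id, show k + 6 - j = 2 + (k + 4 - j) by omega, pow_add, mul_assoc]
    gcongr
    exact le_add_of_nonneg_right (by positivity)
  | succ n ihn =>
    intro x hx
    have hx1 := Ioo_subset_Ioc_self hx
    have hx' := Ioo_subset_Icc_self hx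
    have hx0 := hx.1
    have hy := h.mapsTo_Ioo hx
    rw [Function.iterate_succ_apply', pullbackJet, Finset.sum_range_succ,
      Function.iterate_succ_apply]
    set y := R^[n] (R x) with hyd
    set G := (pullbackJet R)^[n] F
    set q := k + 4 - j with hq
    have e1 : |pullbackCoeff R j j x * G j (R x)| ≤
        (C + S / c) * y ^ 2 * (x ^ q * (1 - c * x)) := by
      rw [abs_mul, abs_of_nonneg (h.pullbackCoeff_self_nonneg hx' j)]
      calc _ ≤ pullbackCoeff R j j x * ((C + S / c) * y ^ 2 * R x ^ q) := by
            gcongr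
            · exact h.pullbackCoeff_self_nonneg hx' j
            · exact ihn _ hy
        _ = (C + S / c) * y ^ 2 * (pullbackCoeff R j j x * R x ^ q) := by ring
        _ ≤ _ := mul_le_mul_of_nonneg_left
            (h.pullbackCoeff_self_mul_le hx1 j (by omega)) (by positivity)
    have e2 : |∑ i ∈ Finset.range j, pullbackCoeff R j i x * G i (R x)| ≤
        S * y ^ 2 * (x ^ q * x) := by
      refine (Finset.abs_sum_le_sum_abs _ _).trans ?_
      rw [hS, Finset.sum_mul, Finset.sum_mul]
      refine Finset.sum_le_sum fun i hi => ?_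
      have hij := Finset.mem_range.1 hi
      rw [abs_mul]
      calc _ ≤ B i * (K i * y ^ 2 * R x ^ (k + 4 - i)) := by
            gcongr
            · exact hB0 i
            · exact hB i x hx'
            · exact hK i hij n _ hy
        _ ≤ B i * (K i * y ^ 2 * (b ^ (j - i - 1) * (x ^ q * x))) := by
            have hle : R x ^ (k + 4 - i) ≤ b ^ (j - i - 1) * (x ^ q * x) := by
              calc R x ^ (k + 4 - i) ≤ x ^ (k + 4 - i) :=
                    pow_le_pow_left₀ hy.1.le (h.map_le hx') _
                _ = x ^ (j - i - 1) * (x ^ q * x) := by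
                    rw [← pow_succ, ← pow_add]; congr 1; omega
                _ ≤ _ := by gcongr; exact hx.2.le
            have h3 := hK0 i hij
            have h4 := hB0 i
            gcongr
        _ = _ := by ring
    calc _ ≤ _ := abs_add_le _ _
      _ ≤ S * y ^ 2 * (x ^ q * x) + (C + S / c) * y ^ 2 * (x ^ q * (1 - c * x)) := add_le_add e2 e1
      _ = (C + S / c) * y ^ 2 * x ^ q - C * c * y ^ 2 * x ^ q * x := by field_simp; ring
      _ ≤ _ := by
        have : 0 ≤ C * c * y ^ 2 * x ^ q * x := by positivity
        linarith

/-- The pullbacks of a vector field that is invariant to high order converge, up to the boundary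
point `0`, together with finitely many derivatives. -/
theorem exists_smooth_limit (h : ParabolicContraction R c b)
    (hR : ∀ x ∈ Icc 0 b, ContDiffAt ℝ ∞ R x) {w : ℝ → ℝ} (hw : ContDiff ℝ ∞ w) (k : ℕ)
    (hO : (fun x => pullback R w x - w x) =O[𝓝 0] fun x => x ^ (k + 6)) :
    ∃ H : ℕ → ℝ → ℝ,
      (∀ x ∈ Ioo 0 b, Tendsto (fun n => (pullback R)^[n] w x) atTop (𝓝 (w x + H 0 x))) ∧
      (∀ j < k, ∀ x ∈ Ioo 0 b, HasDerivAt (H j) (H (j + 1) x) x) ∧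
      ∀ j ≤ k, Tendsto (H j) (𝓝[>] 0) (𝓝 0) := by
  set f : ℝ → ℝ := fun x => pullback R w x - w x with hfd
  have hf : ∀ x ∈ Icc 0 b, ContDiffAt ℝ ∞ f x := fun x hx =>
    ((hw.contDiffAt.comp x (hR x hx)).div (hR x hx).deriv_infty (h.deriv_pos hx).ne').sub
      hw.contDiffAt
  set F : ℕ → ℝ → ℝ := fun j => iteratedDeriv j f with hFd
  have hF : ∀ j, ∀ x ∈ Ioo 0 b, HasDerivAt (F j) (F (j + 1) x) x := fun j x hx =>
    ((hf x (Ioo_subset_Icc_self hx)).nat_of_infty (j + 1)).hasDerivAt_iteratedDeriv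
  obtain ⟨C, hC, hFC⟩ := exists_abs_iteratedDeriv_le h.b_pos hf hO
  choose! K hK0 hK using fun j (hj : j ≤ k) =>
    h.exists_abs_iterate_pullbackJet_le hR hC (fun j hj => hFC j (by omega)) j hj
  have hD := h.hasDerivAt_iterate_pullbackJet hR hF
  set G : ℕ → ℕ → ℝ → ℝ := fun n => (pullbackJet R)^[n] F
  have hG : ∀ j ≤ k, ∀ n, ∀ x ∈ Ioo 0 b,
      |G n j x| ≤ K j * x ^ (k + 4 - j) * (1 / (c * ((n : ℝ) + 1))) ^ 2 := by
    intro j hj n x hx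
    refine (hK j hj n x hx).trans ?_
    rw [mul_right_comm]
    have := hK0 j hj
    have h2 := hx.1
    gcongr
    · exact (h.iterate_mem_Icc (Ioo_subset_Icc_self hx) n).1
    · exact h.iterate_le (Ioo_subset_Icc_self hx) n
  have hsum : ∀ j ≤ k, ∀ x ∈ Ioo 0 b, Summable fun n => G n j x := fun j hj x hx =>
    Summable.of_norm_bounded (h.summable_sq.mul_left _) fun n => hG j hj n x hx
  -- By telescoping, the `n`-th pullback of `w` is `w` plus a partial sum of pullbacks of the defect
  -- `f`; `H j` is the termwise `j`-th derivative of the full series.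
  refine ⟨fun j x => ∑' n, G n j x, fun x hx => ?_, fun j hj x hx => ?_, fun j hj => ?_⟩
  · have h1 := (hsum 0 (by omega) x hx).hasSum.tendsto_sum_nat.const_add (w x)
    refine h1.congr fun n => ?_
    induction n with
    | zero => simp
    | succ n ih =>
      rw [Finset.sum_range_succ, ← add_assoc, ih]
      have : G n 0 x = (pullback R)^[n] (pullback R w - w) x := by
        simp only [G, iterate_pullbackJet_zero]
        rfl
      rw [this, pullback_iterate_sub, Function.iterate_succ_apply]
      simp
  · have hs : Summable fun n : ℕ =>
        K (j + 1) * b ^ (k + 4 - (j + 1)) * (1 / (c * ((n : ℝ) + 1))) ^ 2 := h.summable_sq.mul_left _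
    refine hasDerivAt_tsum_of_isPreconnected hs isOpen_Ioo isPreconnected_Ioo
      (fun n y hy => hD n j y hy) (fun n y hy => ?_) hx (hsum j (by omega) x hx) hx
    refine (hG (j + 1) (by omega) n y hy).trans ?_
    have := hK0 (j + 1) (by omega)
    have h2 := hy.1.le
    have h3 := hy.2.le
    gcongr
  · set T := ∑' n : ℕ, (1 / (c * ((n : ℝ) + 1))) ^ 2
    have h0 : Tendsto (fun x : ℝ => K j * x ^ (k + 4 - j) * T) (𝓝[>] 0) (𝓝 0) := by
      have : Continuous fun x : ℝ => K j * x ^ (k + 4 - j) * T := by fun_prop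
      have h2 := (this.tendsto 0).mono_left (nhdsWithin_le_nhds (s := Ioi 0))
      simpa [show k + 4 - j ≠ 0 by omega] using h2
    refine squeeze_zero_norm' ?_ h0
    filter_upwards [Ioo_mem_nhdsGT h.b_pos] with x hx
    rw [← tsum_mul_left]
    exact tsum_of_norm_bounded (h.summable_sq.mul_left _).hasSum fun n => hG j hj n x hx

end ParabolicContraction

/-! ### Maps with uniform third-order expansions, and their two one-sided contractions. -/

/-- Third-order expansion, with uniform constants, of `Q` at an attracting (from the right)
parabolic fixed point, on an interval that is small with respect to the constants. -/
structure ParabolicExpansion (Q : ℝ → ℝ) (α A B M b : ℝ) : Prop where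
  α_pos : 0 < α
  α_le : α ≤ A
  A_le : A ≤ M
  abs_B_le : |B| ≤ M
  one_le : 1 ≤ M
  b_pos : 0 < b
  b_small : 16 * M * b ≤ α
  b_small' : 16 * M * b ≤ 1
  map_zero : Q 0 = 0
  smooth : ∀ x ∈ Icc (-b) b, ContDiffAt ℝ ∞ Q x
  expansion : ∀ x ∈ Icc (-b) b, |Q x - (x - A * x ^ 2 + B * x ^ 3)| ≤ M * x ^ 4
  deriv_expansion : ∀ x ∈ Icc (-b) b,
    |deriv Q x - (1 - 2 * A * x + 3 * B * x ^ 2)| ≤ M * |x| ^ 3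

/-- The third-order part of the vector field that generates `x - A x ^ 2 + B x ^ 3 + ⋯`. -/
def cubicField (A B x : ℝ) : ℝ := -A * x ^ 2 + (B - A ^ 2) * x ^ 3

/-- The inverse of `Q` on `[-b, b]`, conjugated by `x ↦ -x`. -/
noncomputable def reflectedInverse (Q : ℝ → ℝ) (b s : ℝ) : ℝ :=
  -Function.invFunOn Q (Icc (-b) b) (-s)

/-- The push-forward of a vector field by `x ↦ -x`. -/
def reflectField (w : ℝ → ℝ) (x : ℝ) : ℝ := -w (-x)

/-- The coefficient `B - A ^ 2` is the one that cancels the `x ^ 4` term of the defect. With the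
remainders written as `E * x ^ 4` and `F * x ^ 3`, the defect is a polynomial divisible by `x ^ 5`.
The quotient `Φ` is bounded by compactness, uniformly in all parameters. -/
theorem exists_cubicField_defect_bound (M : ℝ) : ∃ K, 0 ≤ K ∧ ∀ x A B E F : ℝ, |x| ≤ 1 → |A| ≤ M →
    |B| ≤ M → |E| ≤ M → |F| ≤ M →
    |cubicField A B (x - A * x ^ 2 + B * x ^ 3 + E * x ^ 4) -
      (1 - 2 * A * x + 3 * B * x ^ 2 + F * x ^ 3) * cubicField A B x| ≤ K * |x| ^ 5 := by
  let Φ : ℝ × ℝ × ℝ × ℝ × ℝ → ℝ := fun ⟨x, A, B, E, F⟩ =>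
    -A * (2 * E - 2 * A * (B + E * x) + x * (B + E * x) ^ 2) +
      (B - A ^ 2) * (3 * (B + E * x) + 3 * (-A + x * (B + E * x)) ^ 2 +
        x * (-A + x * (B + E * x)) ^ 3) - 3 * B * (B - A ^ 2) + A * F - x * F * (B - A ^ 2)
  have hΦ : Continuous Φ := by
    simp only [Φ]
    fun_prop
  have hc : IsCompact (Icc (-1 : ℝ) 1 ×ˢ Icc (-M) M ×ˢ Icc (-M) M ×ˢ Icc (-M) M ×ˢ Icc (-M) M) :=
    isCompact_Icc.prod (isCompact_Icc.prod (isCompact_Icc.prod (isCompact_Icc.prod isCompact_Icc)))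
  obtain ⟨K, hK⟩ := hc.exists_bound_of_continuousOn hΦ.continuousOn
  refine ⟨max K 0, le_max_right _ _, fun x A B E F hx hA hB hE hF => ?_⟩
  have h1 := hK (x, A, B, E, F) ⟨abs_le.1 hx, abs_le.1 hA, abs_le.1 hB, abs_le.1 hE, abs_le.1 hF⟩
  have e : cubicField A B (x - A * x ^ 2 + B * x ^ 3 + E * x ^ 4) -
      (1 - 2 * A * x + 3 * B * x ^ 2 + F * x ^ 3) * cubicField A B x =
      Φ (x, A, B, E, F) * x ^ 5 := by
    simp only [cubicField, Φ]
    ring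
  rw [e, abs_mul, abs_pow]
  exact mul_le_mul_of_nonneg_right (h1.trans (le_max_left _ _)) (by positivity)

namespace ParabolicExpansion

variable {Q : ℝ → ℝ} {α A B M b : ℝ}

theorem A_pos (h : ParabolicExpansion Q α A B M b) : 0 < A := h.α_pos.trans_le h.α_le

theorem b_le_one (h : ParabolicExpansion Q α A B M b) : b ≤ 1 := by
  nlinarith [h.b_small', h.one_le, h.b_pos]

theorem abs_mul_le (h : ParabolicExpansion Q α A B M b) {x : ℝ} (hx : x ∈ Icc (-b) b) :
    16 * M * |x| ≤ α ∧ 16 * M * |x| ≤ 1 ∧ |x| ≤ 1 := by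
  have h1 : |x| ≤ b := abs_le.2 hx
  have h2 : 16 * M * |x| ≤ 16 * M * b := by
    have := h.one_le; gcongr
  exact ⟨h2.trans h.b_small, h2.trans h.b_small', h1.trans h.b_le_one⟩

theorem abs_quadratic_le (h : ParabolicExpansion Q α A B M b) {x : ℝ} (hx : x ∈ Icc (-b) b) :
    |Q x - (x - A * x ^ 2)| ≤ α / 8 * x ^ 2 := by
  obtain ⟨h1, -, h3⟩ := h.abs_mul_le hx
  have h4 := h.expansion x hx
  have h5 : |B * x ^ 3| ≤ M * |x| ^ 3 := by
    rw [abs_mul, abs_pow]; have := h.abs_B_le; gcongr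
  have e : Q x - (x - A * x ^ 2) = (Q x - (x - A * x ^ 2 + B * x ^ 3)) + B * x ^ 3 := by ring
  rw [e]
  refine (abs_add_le _ _).trans ?_
  have e4 : x ^ 4 = |x| ^ 2 * |x| ^ 2 := by rw [← pow_add, Even.pow_abs ⟨2, rfl⟩]
  have e2 : α / 8 * x ^ 2 = α / 8 * |x| ^ 2 := by rw [sq_abs]
  rw [e4] at h4
  rw [e2]
  set y := |x|
  have hy : 0 ≤ y := abs_nonneg x
  have hM := h.one_le
  have : M * (y ^ 2 * y ^ 2) ≤ M * y * y ^ 2 := by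
    have : M * y * y ^ 2 * y ≤ M * y * y ^ 2 * 1 := by gcongr
    linarith
  have : M * y * y ^ 2 ≤ α / 16 * y ^ 2 := by gcongr; linarith
  have : M * y ^ 3 = M * y * y ^ 2 := by ring
  linarith

theorem abs_deriv_linear_le (h : ParabolicExpansion Q α A B M b) {x : ℝ} (hx : x ∈ Icc (-b) b) :
    |deriv Q x - (1 - 2 * A * x)| ≤ α / 4 * |x| := by
  obtain ⟨h1, -, h3⟩ := h.abs_mul_le hx
  have h4 := h.deriv_expansion x hx
  have h5 : |3 * B * x ^ 2| ≤ 3 * M * |x| ^ 2 := by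
    rw [abs_mul, abs_pow, abs_mul, abs_of_pos (by norm_num : (0 : ℝ) < 3)]
    have := h.abs_B_le; gcongr
  have e : deriv Q x - (1 - 2 * A * x) =
    (deriv Q x - (1 - 2 * A * x + 3 * B * x ^ 2)) + 3 * B * x ^ 2 := by ring
  rw [e]
  refine (abs_add_le _ _).trans ?_
  set y := |x|
  have hy : 0 ≤ y := abs_nonneg x
  have hM := h.one_le
  have : M * y ^ 3 ≤ M * y ^ 2 := by
    have : M * y ^ 2 * y ≤ M * y ^ 2 * 1 := by gcongr
    linarith
  have : M * y * y ≤ α / 16 * y := by gcongr; linarith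
  have : M * y ^ 2 = M * y * y := by ring
  linarith

theorem mul_abs_le (h : ParabolicExpansion Q α A B M b) {x : ℝ} (hx : x ∈ Icc (-b) b) :
    (A + α / 8) * |x| ≤ 1 / 8 := by
  obtain ⟨-, h2, -⟩ := h.abs_mul_le hx
  have : (A + α / 8) * |x| ≤ (2 * M) * |x| := by
    have := h.α_le; have := h.A_le; have := h.A_pos
    gcongr; linarith
  linarith

theorem deriv_pos (h : ParabolicExpansion Q α A B M b) {x : ℝ} (hx : x ∈ Icc (-b) b) :
    1 / 2 ≤ deriv Q x := by
  have h1 := abs_le.1 (h.abs_deriv_linear_le hx)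
  have h2 := h.mul_abs_le hx
  have h3 : A * x ≤ A * |x| := mul_le_mul_of_nonneg_left (le_abs_self x) h.A_pos.le
  nlinarith [h1.1]

/-- The delicate condition is `cube_le`: to first order `(Q x / x) ^ 3` is `1 - 3 * A * x`, while
`Q' x` is `1 - 2 * A * x`. The gap `A * x` absorbs the errors, which are fractions of `α * x`. -/
theorem rightContraction (h : ParabolicExpansion Q α A B M b) :
    ParabolicContraction Q (α / 4) b := by
  have hsub : ∀ {x}, x ∈ Icc 0 b → x ∈ Icc (-b) b := fun hx => ⟨by linarith [hx.1, h.b_pos], hx.2⟩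
  have hα := h.α_pos
  have hA := h.A_pos
  have hαA := h.α_le
  have q0 : ∀ x ∈ Icc 0 b, |Q x - (x - A * x ^ 2)| ≤ α / 8 * x ^ 2 :=
    fun x hx => h.abs_quadratic_le (hsub hx)
  have q1 : ∀ x ∈ Icc 0 b, |deriv Q x - (1 - 2 * A * x)| ≤ α / 4 * x := fun x hx => by
    simpa [abs_of_nonneg hx.1] using h.abs_deriv_linear_le (hsub hx)
  have q2 : ∀ x ∈ Icc 0 b, (A + α / 8) * x ≤ 1 / 8 := fun x hx => by
    simpa [abs_of_nonneg hx.1] using h.mul_abs_le (hsub hx)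
  have pos : ∀ x ∈ Icc 0 b, 7 / 8 * x ≤ Q x := fun x hx => by
    have h1 := abs_le.1 (q0 x hx)
    have h2 := mul_le_mul_of_nonneg_right (q2 x hx) hx.1
    nlinarith [h1.1]
  refine ⟨h.b_pos, by positivity, h.map_zero, fun x hx => ?_, fun x hx => ?_,
    fun x hx => h.deriv_pos (hsub hx), fun x hx => ?_, fun x hx => ?_⟩
  · have := pos x (Ioc_subset_Icc_self hx)
    have := hx.1
    linarith
  · have h1 := abs_le.1 (q0 x hx)
    nlinarith [h1.2, mul_le_mul_of_nonneg_right hαA (sq_nonneg x), mul_nonneg hα.le (sq_nonneg x)]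
  · have h1 := abs_le.1 (q1 x hx)
    nlinarith [h1.2, mul_le_mul_of_nonneg_right hαA hx.1, mul_nonneg hα.le hx.1]
  · have h0 := abs_le.1 (q0 x hx)
    have h1 := abs_le.1 (q1 x hx)
    have h2 := q2 x hx
    have hx0 := hx.1
    set y := (A - α / 8) * x with hy
    have hy0 : 0 ≤ y := mul_nonneg (by linarith) hx0
    have hQ : Q x ≤ x * (1 - y) := by rw [hy]; nlinarith [h0.2]
    have hyA : y ≤ (A + α / 8) * x := by rw [hy]; gcongr; linarith
    have hQ0 : 0 ≤ Q x := le_trans (by positivity) (pos x hx)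
    calc Q x ^ 3 ≤ (x * (1 - y)) ^ 3 := pow_le_pow_left₀ hQ0 hQ 3
      _ = x ^ 3 * (1 - y) ^ 3 := by ring
      _ ≤ x ^ 3 * deriv Q x := by
        gcongr
        have e1 : (1 - y) ^ 3 ≤ 1 - 3 * y + 3 * y ^ 2 := by
          have := pow_nonneg hy0 3
          nlinarith
        have e2 : y ^ 2 ≤ y * (1 / 8) := by
          rw [sq]; gcongr; linarith
        have e3 : 1 - (2 * A + α / 4) * x ≤ deriv Q x := by linarith [h1.1]
        -- Here `21 / 8 = 3 - 3 / 8`, the loss coming from `3 * y ^ 2 ≤ (3 / 8) * y` in `e2`.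
        have e4 : (2 * A + α / 4) * x ≤ (21 / 8) * y := by
          rw [hy, ← mul_assoc]
          gcongr
          linarith
        linarith

theorem hasDerivAt (h : ParabolicExpansion Q α A B M b) {x : ℝ} (hx : x ∈ Icc (-b) b) :
    HasDerivAt Q (deriv Q x) x := ((h.smooth x hx).differentiableAt (by simp)).hasDerivAt

theorem hasStrictDerivAt (h : ParabolicExpansion Q α A B M b) {x : ℝ} (hx : x ∈ Icc (-b) b) :
    HasStrictDerivAt Q (deriv Q x) x := (h.smooth x hx).hasStrictDerivAt (by simp)

theorem continuousOn (h : ParabolicExpansion Q α A B M b) : ContinuousOn Q (Icc (-b) b) :=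
  fun x hx => (h.smooth x hx).continuousAt.continuousWithinAt

theorem strictMonoOn (h : ParabolicExpansion Q α A B M b) : StrictMonoOn Q (Icc (-b) b) :=
  strictMonoOn_of_deriv_pos (convex_Icc _ _) h.continuousOn fun x hx => by
    linarith [h.deriv_pos (interior_subset hx)]

theorem reflectedInverse_apply (h : ParabolicExpansion Q α A B M b) {y : ℝ}
    (hy : y ∈ Icc (-b) b) : reflectedInverse Q b (-Q y) = -y := by
  rw [reflectedInverse, neg_neg, h.strictMonoOn.injOn.leftInvOn_invFunOn hy]

theorem eventually_mem_image (h : ParabolicExpansion Q α A B M b) {y : ℝ} (hy : y ∈ Ioo (-b) b) :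
    ∀ᶠ s in 𝓝 (-Q y), ∃ z ∈ Ioo (-b) b, -Q z = s := by
  have hy' := Ioo_subset_Icc_self hy
  have h1 : Q '' Ioo (-b) b ∈ 𝓝 (Q y) := by
    rw [← (h.hasStrictDerivAt hy').map_nhds_eq (by linarith [h.deriv_pos hy'])]
    exact image_mem_map (Ioo_mem_nhds hy.1 hy.2)
  have h2 : Tendsto (fun s : ℝ => -s) (𝓝 (-Q y)) (𝓝 (Q y)) := by
    simpa using (continuous_neg (G := ℝ)).tendsto (-Q y)
  filter_upwards [h2.eventually h1] with s ⟨z, hz, hzs⟩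
  exact ⟨z, hz, by linarith⟩

theorem contDiffAt_reflectedInverse (h : ParabolicExpansion Q α A B M b) {y : ℝ}
    (hy : y ∈ Ioo (-b) b) : ContDiffAt ℝ ∞ (reflectedInverse Q b) (-Q y) := by
  have hy' := Ioo_subset_Icc_self hy
  have hd : deriv Q y ≠ 0 := by linarith [h.deriv_pos hy']
  set g := Function.invFunOn Q (Icc (-b) b)
  have hg : ∀ᶠ x in 𝓝 y, g (Q x) = x := by
    filter_upwards [Icc_mem_nhds hy.1 hy.2] with x hx
    exact h.strictMonoOn.injOn.leftInvOn_invFunOn hx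
  have hf := ((h.hasDerivAt hy').hasFDerivAt_equiv hd)
  have h1 := (h.smooth y hy').to_localInverse hf (by simp)
  have h2 := ((h.smooth y hy').hasStrictFDerivAt' hf (by simp)).localInverse_unique hg
  have h3 : ContDiffAt ℝ ∞ g (Q y) := h1.congr_of_eventuallyEq h2
  have h4 : ContDiffAt ℝ ∞ g (-(-Q y)) := by rwa [neg_neg]
  exact (h4.comp (-Q y) contDiffAt_id.neg).neg

theorem hasDerivAt_reflectedInverse (h : ParabolicExpansion Q α A B M b) {y : ℝ}
    (hy : y ∈ Ioo (-b) b) : HasDerivAt (reflectedInverse Q b) (deriv Q y)⁻¹ (-Q y) := by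
  have hy' := Ioo_subset_Icc_self hy
  have hd : deriv Q y ≠ 0 := by linarith [h.deriv_pos hy']
  have hg : ∀ᶠ x in 𝓝 y, Function.invFunOn Q (Icc (-b) b) (Q x) = x := by
    filter_upwards [Icc_mem_nhds hy.1 hy.2] with x hx
    exact h.strictMonoOn.injOn.leftInvOn_invFunOn hx
  have h1 := ((h.hasStrictDerivAt hy').to_local_left_inverse hd hg).hasDerivAt
  have h2 : HasDerivAt (fun s : ℝ => -s) (-1) (-Q y) := hasDerivAt_neg _
  have h3 := (HasDerivAt.comp (-Q y) (by rwa [neg_neg]) h2).neg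
  exact h3.congr_deriv (by simp)

theorem le_neg_map_neg (h : ParabolicExpansion Q α A B M b) {t : ℝ} (ht : t ∈ Icc 0 b) :
    t + 7 / 8 * α * t ^ 2 ≤ -Q (-t) ∧ t + (A - α / 8) * t ^ 2 ≤ -Q (-t) ∧
      -Q (-t) ≤ t + (A + α / 8) * t ^ 2 := by
  have h0 := abs_le.1 (h.abs_quadratic_le (x := -t) ⟨by linarith [ht.2], by linarith [ht.1, h.b_pos]⟩)
  rw [neg_sq] at h0
  have := mul_le_mul_of_nonneg_right h.α_le (sq_nonneg t)
  refine ⟨?_, ?_, ?_⟩ <;> nlinarith [h0.1, h0.2]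

/-- Since `-Q (-b) > b`, the preimage stays strictly inside the interval, so the reflected inverse
is differentiable even at `s = b`. -/
theorem exists_neg_map_neg_eq (h : ParabolicExpansion Q α A B M b) {s : ℝ} (hs : s ∈ Icc 0 b) :
    ∃ t ∈ Icc 0 b, -t ∈ Ioo (-b) b ∧ -Q (-t) = s := by
  have hb := h.b_pos
  have hc : ContinuousOn (fun t => -Q (-t)) (Icc 0 b) := by
    refine (h.continuousOn.comp continuous_neg.continuousOn fun t ht => ?_).neg
    exact ⟨by linarith [ht.2], by linarith [ht.1]⟩
  have hbb := (h.le_neg_map_neg (t := b) ⟨hb.le, le_rfl⟩).1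
  have hα := mul_pos h.α_pos (pow_pos hb 2)
  obtain ⟨t, ht, hts⟩ := intermediate_value_Icc hb.le hc
    (show s ∈ Icc (-Q (-0)) (-Q (-b)) by
      rw [neg_zero, h.map_zero, neg_zero]; exact ⟨hs.1, by linarith [hs.2]⟩)
  simp only at hts
  have htb : t ≠ b := by
    rintro rfl
    linarith [hs.2]
  exact ⟨t, ht, ⟨by linarith [lt_of_le_of_ne ht.2 htb], by linarith [ht.1]⟩, hts⟩

/-- On the left `Q` moves points away from `0`, so its inverse contracts. In the parameter `t` with
`s = -Q (-t)`, the cube inequality reads `t ^ 3 * Q' (-t) ≤ s ^ 3`, and follows by comparing `1 + 2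
* A * t` with `(1 + A * t) ^ 3`, up to the error terms. -/
theorem leftContraction (h : ParabolicExpansion Q α A B M b) :
    ParabolicContraction (reflectedInverse Q b) (α / 4) b := by
  have hα := h.α_pos
  have hA := h.A_pos
  have hαA := h.α_le
  have hb := h.b_pos
  have hmem : ∀ {t}, t ∈ Icc 0 b → -t ∈ Icc (-b) b := fun ht =>
    ⟨by linarith [ht.2], by linarith [ht.1]⟩
  have q1 : ∀ t ∈ Icc 0 b, |deriv Q (-t) - (1 + 2 * A * t)| ≤ α / 4 * t := fun t ht => by
    simpa [abs_of_nonneg ht.1] using h.abs_deriv_linear_le (hmem ht)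
  have q2 : ∀ t ∈ Icc 0 b, (A + α / 8) * t ≤ 1 / 8 := fun t ht => by
    simpa [abs_of_nonneg ht.1] using h.mul_abs_le (hmem ht)
  have hL : ∀ s ∈ Icc 0 b, ∃ t ∈ Icc 0 b, reflectedInverse Q b s = t ∧ -Q (-t) = s ∧
      deriv (reflectedInverse Q b) s = (deriv Q (-t))⁻¹ := by
    intro s hs
    obtain ⟨t, ht, htb, rfl⟩ := h.exists_neg_map_neg_eq hs
    refine ⟨t, ht, ?_, rfl, (h.hasDerivAt_reflectedInverse htb).deriv⟩
    rw [h.reflectedInverse_apply (Ioo_subset_Icc_self htb), neg_neg]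
  have hd : ∀ t ∈ Icc 0 b, 1 ≤ deriv Q (-t) ∧ deriv Q (-t) ≤ 2 := fun t ht => by
    have h1 := abs_le.1 (q1 t ht)
    have h2 := q2 t ht
    have := mul_le_mul_of_nonneg_right hαA ht.1
    have := mul_nonneg hα.le ht.1
    constructor
    · nlinarith [h1.1]
    · nlinarith [h1.2]
  refine ⟨hb, by positivity, ?_, fun s hs => ?_, fun s hs => ?_, fun s hs => ?_, fun s hs => ?_,
    fun s hs => ?_⟩
  · have := h.reflectedInverse_apply (y := 0) ⟨by linarith, hb.le⟩
    simpa [h.map_zero] using this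
  · obtain ⟨t, ht, h1, h2, -⟩ := hL s (Ioc_subset_Icc_self hs)
    rw [h1]
    refine lt_of_le_of_ne ht.1 fun h0 => ?_
    rw [← h0, neg_zero, h.map_zero, neg_zero] at h2
    exact hs.1.ne h2
  · obtain ⟨t, ht, h1, h2, -⟩ := hL s hs
    rw [h1]
    obtain ⟨e1, -, e3⟩ := h.le_neg_map_neg ht
    rw [h2] at e1 e3
    have e4 : s ≤ 9 / 8 * t := by
      have := mul_le_mul_of_nonneg_right (q2 t ht) ht.1
      nlinarith
    have e5 : s ^ 2 ≤ (9 / 8 * t) ^ 2 := pow_le_pow_left₀ hs.1 e4 2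
    have := mul_le_mul_of_nonneg_left e5 hα.le
    nlinarith [mul_nonneg hα.le (sq_nonneg t)]
  · obtain ⟨t, ht, -, -, h3⟩ := hL s hs
    obtain ⟨e1, e2⟩ := hd t ht
    rw [h3, one_div]
    exact inv_anti₀ (by linarith) e2
  · obtain ⟨t, ht, -, -, h3⟩ := hL s hs
    rw [h3]
    exact inv_le_one_of_one_le₀ (hd t ht).1
  · obtain ⟨t, ht, h1, h2, h3⟩ := hL s hs
    obtain ⟨-, e1, -⟩ := h.le_neg_map_neg ht
    have e0 := (hd t ht).1
    rw [h1, h3, ← div_eq_mul_inv, le_div_iff₀ (by linarith)]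
    rw [h2] at e1
    set y := (A - α / 8) * t with hy
    have ht0 := ht.1
    have hy0 : 0 ≤ y := mul_nonneg (by linarith) ht0
    calc t ^ 3 * deriv Q (-t) ≤ t ^ 3 * (1 + y) ^ 3 := by
          gcongr
          have e2 := abs_le.1 (q1 t ht)
          have e4 : (2 * A + α / 4) * t ≤ 3 * y := by
            rw [hy, ← mul_assoc]
            gcongr
            linarith
          have := pow_nonneg hy0 3
          nlinarith [e2.2, sq_nonneg y]
      _ = (t * (1 + y)) ^ 3 := by ring
      _ ≤ s ^ 3 := by
          gcongr
          rw [hy]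
          linarith

theorem contDiffAt_reflectedInverse_of_mem (h : ParabolicExpansion Q α A B M b) {s : ℝ}
    (hs : s ∈ Icc 0 b) : ContDiffAt ℝ ∞ (reflectedInverse Q b) s := by
  obtain ⟨t, -, htb, rfl⟩ := h.exists_neg_map_neg_eq hs
  exact h.contDiffAt_reflectedInverse htb

theorem contDiffAt_of_mem (h : ParabolicExpansion Q α A B M b) {x : ℝ}
    (hx : x ∈ Icc 0 b) : ContDiffAt ℝ ∞ Q x :=
  h.smooth x ⟨by linarith [hx.1, h.b_pos], hx.2⟩

/-- Invariance of a vector field under `Q` is the same as invariance of the reflected field under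
the reflected inverse. -/
theorem pullback_reflectField (h : ParabolicExpansion Q α A B M b) (w : ℝ → ℝ) {y : ℝ}
    (hy : y ∈ Ioo (-b) b) :
    pullback (reflectedInverse Q b) (reflectField w) (-Q y) - reflectField w (-Q y) =
      w (Q y) - deriv Q y * w y := by
  rw [pullback, (h.hasDerivAt_reflectedInverse hy).deriv,
    h.reflectedInverse_apply (Ioo_subset_Icc_self hy)]
  simp only [reflectField, neg_neg, div_inv_eq_mul]
  ring

theorem exists_cubicField_bound (M : ℝ) : ∃ K, 0 ≤ K ∧ ∀ {Q : ℝ → ℝ} {α A B b : ℝ},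
    ParabolicExpansion Q α A B M b → ∀ x ∈ Icc (-b) b,
      |cubicField A B (Q x) - deriv Q x * cubicField A B x| ≤ K * |x| ^ 5 := by
  obtain ⟨K, hK0, hK⟩ := exists_cubicField_defect_bound M
  refine ⟨K, hK0, fun {Q α A B b} h x hx => ?_⟩
  rcases eq_or_ne x 0 with rfl | hx0
  · simp [h.map_zero, cubicField]
  have hE : |(Q x - (x - A * x ^ 2 + B * x ^ 3)) / x ^ 4| ≤ M := by
    rw [abs_div, abs_of_pos (show 0 < x ^ 4 by positivity), div_le_iff₀ (by positivity)]
    exact h.expansion x hx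
  have hF : |(deriv Q x - (1 - 2 * A * x + 3 * B * x ^ 2)) / x ^ 3| ≤ M := by
    rw [abs_div, div_le_iff₀ (by positivity), abs_pow]
    exact h.deriv_expansion x hx
  have h1 := hK x A B _ _ (h.abs_mul_le hx).2.2 (by rw [abs_of_pos h.A_pos]; exact h.A_le)
    h.abs_B_le hE hF
  rw [div_mul_cancel₀ _ (by positivity), div_mul_cancel₀ _ (by positivity), add_sub_cancel,
    add_sub_cancel] at h1
  exact h1

/-- `K` depends on `M` alone, which gives nearby maps a common tail bound. The factor `2` comes from
`Q' ≥ 1 / 2` on the right; on the left, `t ≤ s` transfers the bound from `t` to `s`. -/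
theorem exists_pullback_cubicField_bound (M : ℝ) : ∃ K, 0 ≤ K ∧ ∀ {Q : ℝ → ℝ} {α A B b : ℝ},
    ParabolicExpansion Q α A B M b →
      (∀ x ∈ Icc 0 b, |pullback Q (cubicField A B) x - cubicField A B x| ≤ K * x ^ 5) ∧
      ∀ x ∈ Icc 0 b, |pullback (reflectedInverse Q b) (reflectField (cubicField A B)) x -
        reflectField (cubicField A B) x| ≤ K * x ^ 5 := by
  obtain ⟨K, hK0, hK⟩ := exists_cubicField_bound M
  refine ⟨2 * K, by positivity, fun {Q α A B b} h => ⟨fun x hx => ?_, fun s hs => ?_⟩⟩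
  · have hx' : x ∈ Icc (-b) b := ⟨by linarith [hx.1, h.b_pos], hx.2⟩
    have h1 := hK h x hx'
    have hd := h.deriv_pos hx'
    rw [abs_of_nonneg hx.1] at h1
    have e : pullback Q (cubicField A B) x - cubicField A B x =
        (cubicField A B (Q x) - deriv Q x * cubicField A B x) / deriv Q x := by
      rw [pullback]; field_simp
    rw [e, abs_div, abs_of_pos (by linarith : 0 < deriv Q x), div_le_iff₀ (by linarith)]
    have : 0 ≤ K * x ^ 5 := mul_nonneg hK0 (pow_nonneg hx.1 5)
    nlinarith
  · obtain ⟨t, ht, htb, rfl⟩ := h.exists_neg_map_neg_eq hs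
    rw [h.pullback_reflectField _ htb]
    refine (hK h _ (Ioo_subset_Icc_self htb)).trans ?_
    rw [abs_neg, abs_of_nonneg ht.1]
    have h3 : t ≤ -Q (-t) := by
      have := (h.le_neg_map_neg ht).1
      have := mul_nonneg h.α_pos.le (sq_nonneg t)
      linarith
    have h4 := pow_le_pow_left₀ ht.1 h3 5
    have := pow_nonneg ht.1 5
    nlinarith

theorem zero_mem (h : ParabolicExpansion Q α A B M b) : (0 : ℝ) ∈ Ioo (-b) b :=
  ⟨by linarith [h.b_pos], h.b_pos⟩

theorem isBigO_expansion (h : ParabolicExpansion Q α A B M b) :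
    (fun x => Q x - (x - A * x ^ 2)) =O[𝓝 0] (fun x => x ^ 3) ∧
    (fun x => deriv Q x - (1 - 2 * A * x)) =O[𝓝 0] (fun x => x ^ 2) := by
  have hn : ∀ᶠ x in 𝓝 (0 : ℝ), x ∈ Icc (-b) b := Icc_mem_nhds h.zero_mem.1 h.zero_mem.2
  constructor
  · have h1 : (fun x => Q x - (x - A * x ^ 2 + B * x ^ 3)) =O[𝓝 0] (fun x => x ^ 4) :=
      Asymptotics.IsBigO.of_bound M (hn.mono fun x hx => by
        have := h.expansion x hx
        rwa [Real.norm_eq_abs, Real.norm_eq_abs, abs_of_nonneg (by positivity : 0 ≤ x ^ 4)])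
    exact ((h1.trans (pow_succ_isBigO_pow 3)).add
      ((Asymptotics.isBigO_refl (fun x : ℝ => x ^ 3) _).const_mul_left B)).congr_left
        fun x => by ring
  · have h1 : (fun x => deriv Q x - (1 - 2 * A * x + 3 * B * x ^ 2)) =O[𝓝 0] (fun x => x ^ 3) :=
      Asymptotics.IsBigO.of_bound M (hn.mono fun x hx => by
        have := h.deriv_expansion x hx
        rwa [Real.norm_eq_abs, Real.norm_eq_abs, abs_pow])
    exact ((h1.trans (pow_succ_isBigO_pow 2)).add
      ((Asymptotics.isBigO_refl (fun x : ℝ => x ^ 2) _).const_mul_left (3 * B))).congr_left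
        fun x => by ring

/-- Smooth vector fields that are invariant to arbitrary order on both sides of the fixed point. -/
theorem exists_approx_invariant (h : ParabolicExpansion Q α A B M b) (N : ℕ) :
    ∃ w : ℝ → ℝ, ContDiff ℝ ∞ w ∧ (fun x => w x - cubicField A B x) =O[𝓝 0] (fun x => x ^ 4) ∧
      (fun x => pullback Q w x - w x) =O[𝓝 0] (fun x => x ^ (N + 5)) ∧
      (fun x => pullback (reflectedInverse Q b) (reflectField w) x - reflectField w x)
        =O[𝓝 0] fun x => x ^ (N + 5) := by
  have hb := h.b_pos
  have h0 := Ioo_subset_Icc_self h.zero_mem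
  have hn : ∀ᶠ x in 𝓝 (0 : ℝ), x ∈ Icc (-b) b := Icc_mem_nhds h.zero_mem.1 h.zero_mem.2
  obtain ⟨K, hK0, hK⟩ := exists_cubicField_bound M
  have hd : (fun x => cubicField A B (Q x) - deriv Q x * cubicField A B x)
      =O[𝓝 0] fun x => x ^ 5 :=
    Asymptotics.IsBigO.of_bound K (hn.mono fun x hx => by
      simpa using hK h x hx)
  obtain ⟨w, hw, h1, h2⟩ := exists_formal_invariant (h.smooth 0 h0) h.A_pos.ne'
    h.isBigO_expansion.1 h.isBigO_expansion.2
    (w₀ := cubicField A B) (by unfold cubicField; fun_prop) hd N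
  refine ⟨w, hw, h1, ?_, ?_⟩
  · have hinv : (fun x => (deriv Q x)⁻¹) =O[𝓝 0] fun _ => (1 : ℝ) := by
      refine Asymptotics.IsBigO.of_bound 2 (hn.mono fun x hx => ?_)
      have := h.deriv_pos hx
      rw [norm_inv, Real.norm_eq_abs, abs_of_pos (by linarith), norm_one, mul_one]
      exact inv_le_of_inv_le₀ (by norm_num) (by linarith)
    refine (h2.mul hinv).congr' (hn.mono fun x hx => ?_) (.of_forall fun x => mul_one _)
    have := h.deriv_pos hx
    have : deriv Q x ≠ 0 := by linarith
    simp only [pullback]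
    field_simp
  -- The reflected defect at `s` is the original defect at `-L s`, and `L s = O(s)`, so the order is
  -- preserved.
  · set L := reflectedInverse Q b
    have hL0 : L 0 = 0 := h.leftContraction.map_zero
    have hLd : DifferentiableAt ℝ L 0 :=
      (h.contDiffAt_reflectedInverse_of_mem ⟨le_rfl, hb.le⟩).differentiableAt (by simp)
    have hLO : L =O[𝓝 0] fun x => x := by
      simpa [hL0] using hLd.isBigO_sub
    have ht : Tendsto (fun s => -L s) (𝓝 0) (𝓝 0) := by
      have := hLd.continuousAt.tendsto.neg
      rwa [hL0, neg_zero] at this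
    have h3 := (h2.comp_tendsto ht).trans (hLO.neg_left.pow (N + 5))
    refine h3.congr' ?_ (.of_forall fun x => rfl)
    have := h.eventually_mem_image h.zero_mem
    rw [h.map_zero, neg_zero] at this
    filter_upwards [this] with s ⟨z, hz, hzs⟩
    rw [← hzs, h.pullback_reflectField w hz]
    simp only [Function.comp_apply, L, h.reflectedInverse_apply (Ioo_subset_Icc_self hz), neg_neg]

end ParabolicExpansion

/-! ### Gluing the two halves into a smooth invariant field. -/

theorem contDiffOn_of_deriv_tower {S : Set ℝ} (hS : IsOpen S) (k : ℕ) {F : ℕ → ℝ → ℝ}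
    (hF : ∀ j < k + 1, ∀ x ∈ S, HasDerivAt (F j) (F (j + 1) x) x) : ContDiffOn ℝ k (F 0) S := by
  induction k generalizing F with
  | zero =>
    simp only [Nat.cast_zero, contDiffOn_zero]
    exact fun x hx => (hF 0 one_pos x hx).continuousAt.continuousWithinAt
  | succ k ih =>
    push_cast
    rw [contDiffOn_succ_iff_deriv_of_isOpen hS]
    refine ⟨fun x hx => (hF 0 (by omega) x hx).differentiableAt.differentiableWithinAt,
      fun h => absurd h (by exact_mod_cast WithTop.coe_ne_top), ?_⟩
    refine (ih (F := fun j => F (j + 1)) fun j hj x hx => hF (j + 1) (by omega) x hx).congr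
      fun x hx => (hF 0 (by omega) x hx).deriv

/-- A continuous function whose derivative has a limit at a point is differentiable there; this is
applied on each side. -/
theorem hasDerivAt_zero_of_tendsto {f g : ℝ → ℝ} {r : ℝ} (hr : 0 < r) (h0 : f 0 = 0)
    (hf : Tendsto f (𝓝[≠] 0) (𝓝 0)) (hg : Tendsto g (𝓝[≠] 0) (𝓝 0))
    (hfg : ∀ x ∈ Ioo (-r) r, x ≠ 0 → HasDerivAt f (g x) x) : HasDerivAt f 0 0 := by
  have hc : ContinuousAt f 0 := continuousAt_iff_punctured_nhds.2 (by rwa [h0])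
  have hR : Ioo 0 r ∈ 𝓝[>] (0 : ℝ) := Ioo_mem_nhdsGT hr
  have hL : Ioo (-r) 0 ∈ 𝓝[<] (0 : ℝ) := Ioo_mem_nhdsLT (by linarith)
  have dR : ∀ x ∈ Ioo 0 r, HasDerivAt f (g x) x := fun x hx =>
    hfg x ⟨by linarith [hx.1], hx.2⟩ hx.1.ne'
  have dL : ∀ x ∈ Ioo (-r) 0, HasDerivAt f (g x) x := fun x hx =>
    hfg x ⟨hx.1, by linarith [hx.2]⟩ hx.2.ne
  have h1 : HasDerivWithinAt f 0 (Ici 0) 0 :=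
    hasDerivWithinAt_Ici_of_tendsto_deriv
      (fun x hx => (dR x hx).differentiableAt.differentiableWithinAt) hc.continuousWithinAt hR
      ((hg.mono_left (nhdsWithin_mono _ fun x (hx : 0 < x) => hx.ne')).congr'
        (by filter_upwards [hR] with x hx using (dR x hx).deriv.symm))
  have h2 : HasDerivWithinAt f 0 (Iic 0) 0 :=
    hasDerivWithinAt_Iic_of_tendsto_deriv
      (fun x hx => (dL x hx).differentiableAt.differentiableWithinAt) hc.continuousWithinAt hL
      ((hg.mono_left (nhdsWithin_mono _ fun x (hx : x < 0) => hx.ne)).congr'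
        (by filter_upwards [hL] with x hx using (dL x hx).deriv.symm))
  simpa using h2.union h1

theorem tendsto_neg_nhdsLT_zero : Tendsto (fun x : ℝ => -x) (𝓝[<] 0) (𝓝[>] 0) := by
  simpa using tendsto_neg_nhdsLT (a := (0 : ℝ))

/-- The vector field invariant under `Q`, obtained as a limit on both sides of `0`. -/
noncomputable def invariantField (Q : ℝ → ℝ) (A B b x : ℝ) : ℝ :=
  if 0 ≤ x then pullbackLim Q (cubicField A B) x
  else -pullbackLim (reflectedInverse Q b) (reflectField (cubicField A B)) (-x)

namespace ParabolicExpansion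

variable {Q : ℝ → ℝ} {α A B M b : ℝ}

theorem invariantField_of_nonneg {x : ℝ} (hx : 0 ≤ x) :
    invariantField Q A B b x = pullbackLim Q (cubicField A B) x := if_pos hx

theorem reflectField_invariantField {x : ℝ} (hx : 0 < x) :
    reflectField (invariantField Q A B b) x =
      pullbackLim (reflectedInverse Q b) (reflectField (cubicField A B)) x := by
  rw [reflectField, invariantField, if_neg (by linarith), neg_neg, neg_neg]

theorem invariantField_right (h : ParabolicExpansion Q α A B M b) {x : ℝ} (hx : x ∈ Ioo 0 b) :
    invariantField Q A B b (Q x) = deriv Q x * invariantField Q A B b x := by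
  obtain ⟨K, hK0, hK⟩ := exists_pullback_cubicField_bound M
  have hc := h.rightContraction
  rw [invariantField_of_nonneg hx.1.le, invariantField_of_nonneg (hc.mapsTo_Ioo hx).1.le]
  exact hc.pullbackLim_invariant hK0 (hK h).1 (Ioo_subset_Icc_self hx)

theorem invariantField_left (h : ParabolicExpansion Q α A B M b) {s : ℝ} (hs : s ∈ Ioo 0 b) :
    reflectField (invariantField Q A B b) (reflectedInverse Q b s) =
      deriv (reflectedInverse Q b) s * reflectField (invariantField Q A B b) s := by
  obtain ⟨K, hK0, hK⟩ := exists_pullback_cubicField_bound M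
  have hc := h.leftContraction
  rw [reflectField_invariantField hs.1, reflectField_invariantField (hc.mapsTo_Ioo hs).1]
  exact hc.pullbackLim_invariant hK0 (hK h).2 (Ioo_subset_Icc_self hs)

theorem exists_abs_invariantField_sub_le (h : ParabolicExpansion Q α A B M b) :
    ∃ C, ∀ x ∈ Icc (-b) b, |invariantField Q A B b x - cubicField A B x| ≤ C * |x| ^ 3 := by
  obtain ⟨K, hK0, hK⟩ := exists_pullback_cubicField_bound M
  obtain ⟨C, hC⟩ := h.rightContraction.abs_pullbackLim_sub_le hK0 (hK h).1
  obtain ⟨D, hD⟩ := h.leftContraction.abs_pullbackLim_sub_le hK0 (hK h).2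
  refine ⟨max C D, fun x hx => ?_⟩
  rcases le_or_gt 0 x with h0 | h0
  · rw [invariantField_of_nonneg h0, abs_of_nonneg h0]
    exact (hC x ⟨h0, hx.2⟩).trans
      (mul_le_mul_of_nonneg_right (le_max_left _ _) (pow_nonneg h0 3))
  · have hx' : 0 < -x := by linarith
    have h1 := hD (-x) ⟨hx'.le, by linarith [hx.1]⟩
    rw [← reflectField_invariantField hx'] at h1
    simp only [reflectField, neg_neg] at h1
    rw [abs_of_neg h0, ← abs_neg]
    refine le_trans (by rw [neg_sub', neg_sub_neg]; simpa [neg_add_eq_sub] using h1)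
      (mul_le_mul_of_nonneg_right (le_max_right _ _) (pow_nonneg hx'.le 3))

theorem invariantField_zero (h : ParabolicExpansion Q α A B M b) :
    invariantField Q A B b 0 = 0 := by
  obtain ⟨C, hC⟩ := h.exists_abs_invariantField_sub_le
  simpa [cubicField] using hC 0 (Ioo_subset_Icc_self h.zero_mem)

/-- The auxiliary `w` depends on `k` but agrees with `cubicField` to fourth order, so the limit does
not. As `w` is smooth across `0`, only the correction series has to be glued, and its derivatives
tend to `0` from both sides. -/
theorem contDiffOn_invariantField_nat (h : ParabolicExpansion Q α A B M b) (k : ℕ) :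
    ContDiffOn ℝ k (invariantField Q A B b) (Ioo (-b) b) := by
  obtain ⟨K, hK0, hK⟩ := exists_pullback_cubicField_bound M
  -- The resulting order is `(k + 1) + 6`, as `exists_smooth_limit` requires at level `k + 1`; the
  -- extra derivative serves the differentiability of the `k`-th one at `0`.
  obtain ⟨w, hw, hw3, hwR, hwL⟩ := h.exists_approx_invariant (k + 1 + 1)
  have hw' : ContDiff ℝ ∞ (reflectField w) := by unfold reflectField; fun_prop
  have hw3' : (fun x => reflectField w x - reflectField (cubicField A B) x)
      =O[𝓝 0] fun x => x ^ 4 := by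
    have h1 := hw3.comp_tendsto (k := fun x : ℝ => -x)
      (by simpa using (continuous_neg (G := ℝ)).tendsto 0)
    refine (h1.neg_left.congr (fun x => ?_) fun x => ?_)
    · simp [reflectField]; ring
    · simp [Even.neg_pow ⟨2, rfl⟩]
  obtain ⟨H, hH0, hH1, hH2⟩ := h.rightContraction.exists_smooth_limit
    (fun x hx => h.contDiffAt_of_mem hx) hw (k + 1) hwR
  obtain ⟨G, hG0, hG1, hG2⟩ := h.leftContraction.exists_smooth_limit
    (fun x hx => h.contDiffAt_reflectedInverse_of_mem hx) hw' (k + 1) hwL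
  -- On the left the function is `-G 0 (-x)`, and each differentiation adds one more sign.
  set F : ℕ → ℝ → ℝ := fun j x =>
    if 0 < x then H j x else if x < 0 then (-1) ^ (j + 1) * G j (-x) else 0 with hF
  have hFR : ∀ j, ∀ x : ℝ, 0 < x → F j x = H j x := fun j x hx => if_pos hx
  have hFL : ∀ j, ∀ x : ℝ, x < 0 → F j x = (-1) ^ (j + 1) * G j (-x) := fun j x hx => by
    simp only [hF]
    rw [if_neg hx.not_gt, if_pos hx]
  have hF0 : ∀ j, F j 0 = 0 := fun j => by simp [hF]
  have hlim : ∀ j ≤ k + 1, Tendsto (F j) (𝓝[≠] 0) (𝓝 0) := by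
    intro j hj
    rw [← Iio_union_Ioi, nhdsWithin_union, tendsto_sup]
    constructor
    · have h1 := ((hG2 j hj).comp tendsto_neg_nhdsLT_zero).const_mul ((-1) ^ (j + 1))
      rw [mul_zero] at h1
      exact h1.congr' (by filter_upwards [self_mem_nhdsWithin] with x hx using (hFL j x hx).symm)
    · exact (hH2 j hj).congr'
        (by filter_upwards [self_mem_nhdsWithin] with x hx using (hFR j x hx).symm)
  have hder : ∀ j < k + 1, ∀ x ∈ Ioo (-b) b, x ≠ 0 → HasDerivAt (F j) (F (j + 1) x) x := by
    intro j hj x hx hx0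
    rcases hx0.lt_or_gt with h0 | h0
    · have hm : -x ∈ Ioo 0 b := ⟨by linarith, by linarith [hx.1]⟩
      have h1 := ((hG1 j hj _ hm).comp x (hasDerivAt_neg x)).const_mul ((-1) ^ (j + 1))
      rw [hFL _ _ h0]
      refine (h1.congr_deriv (by ring)).congr_of_eventuallyEq ?_
      filter_upwards [Iio_mem_nhds h0] with y hy using hFL j y hy
    · rw [hFR _ _ h0]
      refine (hH1 j hj x ⟨h0, hx.2⟩).congr_of_eventuallyEq ?_
      filter_upwards [Ioi_mem_nhds h0] with y hy using hFR j y hy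
  have htower : ∀ j < k + 1, ∀ x ∈ Ioo (-b) b, HasDerivAt (F j) (F (j + 1) x) x := by
    intro j hj x hx
    rcases eq_or_ne x 0 with rfl | hx0
    · rw [hF0]
      exact hasDerivAt_zero_of_tendsto h.b_pos (hF0 j) (hlim j (by omega)) (hlim (j + 1) (by omega))
        (hder j hj)
    · exact hder j hj x hx hx0
  have h1 := contDiffOn_of_deriv_tower isOpen_Ioo k htower
  refine ((hw.of_le (by exact_mod_cast le_top)).contDiffOn.add h1).congr fun x hx => ?_
  rcases lt_trichotomy x 0 with h0 | rfl | h0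
  · have hm : -x ∈ Ioo 0 b := ⟨by linarith, by linarith [hx.1]⟩
    have e := tendsto_nhds_unique (h.leftContraction.tendsto_pullbackLim_of_isBigO hK0 (hK h).2 hw3'
      (Ioo_subset_Ioc_self hm)) (hG0 _ hm)
    rw [← reflectField_invariantField hm.1] at e
    simp only [reflectField, neg_neg] at e
    rw [hFL 0 x h0, zero_add, pow_one]
    linarith
  · obtain ⟨c, hc⟩ := hw3.bound
    have := hc.self_of_nhds
    simp [cubicField] at this
    rw [h.invariantField_zero, hF0, this, add_zero]
  · have e := tendsto_nhds_unique (h.rightContraction.tendsto_pullbackLim_of_isBigO hK0 (hK h).1 hw3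
      ⟨h0, hx.2.le⟩) (hH0 x ⟨h0, hx.2⟩)
    rw [invariantField_of_nonneg h0.le, hFR 0 x h0]
    exact e

theorem contDiffOn_invariantField (h : ParabolicExpansion Q α A B M b) :
    ContDiffOn ℝ ∞ (invariantField Q A B b) (Ioo (-b) b) :=
  contDiffOn_infty.2 h.contDiffOn_invariantField_nat

theorem iteratedDeriv_invariantField (h : ParabolicExpansion Q α A B M b) {j : ℕ} (hj : j < 3) :
    iteratedDeriv j (invariantField Q A B b) 0 = iteratedDeriv j (cubicField A B) 0 := by
  have hn : Ioo (-b) b ∈ 𝓝 (0 : ℝ) := Ioo_mem_nhds h.zero_mem.1 h.zero_mem.2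
  have h1 : ContDiffAt ℝ ∞ (invariantField Q A B b) 0 := h.contDiffOn_invariantField.contDiffAt hn
  have h2 : ContDiffAt ℝ ∞ (cubicField A B) 0 := by
    unfold cubicField; fun_prop
  obtain ⟨C, hC⟩ := h.exists_abs_invariantField_sub_le
  have hO : (invariantField Q A B b - cubicField A B) =O[𝓝 0] fun x => x ^ 3 :=
    Asymptotics.IsBigO.of_bound C (by
      filter_upwards [hn] with x hx
      simpa using hC x (Ioo_subset_Icc_self hx))
  have h3 : iteratedDeriv j (invariantField Q A B b - cubicField A B) 0 = 0 :=
    iteratedDeriv_eq_zero_of_isBigO (h1.sub h2) hO j hj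
  rw [iteratedDeriv_sub (h1.nat_of_infty j) (h2.nat_of_infty j)] at h3
  linarith

theorem deriv_cubicField (A B x : ℝ) :
    HasDerivAt (cubicField A B) (-2 * A * x + 3 * (B - A ^ 2) * x ^ 2) x := by
  have h1 := ((hasDerivAt_pow 2 x).const_mul (-A)).add ((hasDerivAt_pow 3 x).const_mul (B - A ^ 2))
  refine h1.congr_deriv ?_
  push_cast
  ring

theorem iteratedDeriv_two_cubicField (A B : ℝ) : iteratedDeriv 2 (cubicField A B) 0 = -2 * A := by
  have e : deriv (cubicField A B) = fun x => -2 * A * x + 3 * (B - A ^ 2) * x ^ 2 :=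
    funext fun x => (deriv_cubicField A B x).deriv
  rw [iteratedDeriv_succ, iteratedDeriv_one, e]
  have h1 := ((hasDerivAt_id (0 : ℝ)).const_mul (-2 * A)).add
    ((hasDerivAt_pow 2 (0 : ℝ)).const_mul (3 * (B - A ^ 2)))
  refine h1.deriv.trans ?_
  simp

theorem deriv_invariantField (h : ParabolicExpansion Q α A B M b) :
    deriv (invariantField Q A B b) 0 = 0 := by
  have := h.iteratedDeriv_invariantField (j := 1) (by norm_num)
  rw [iteratedDeriv_one, iteratedDeriv_one, (deriv_cubicField A B 0).deriv] at this
  simpa using this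

end ParabolicExpansion

/-! ### Flows of one-dimensional fields and time functions. -/

/-- The time-one flow of the vector field `h`, inside `V`, takes `x` to `y`. -/
def FlowsTo (h : ℝ → ℝ) (V : Set ℝ) (x y : ℝ) : Prop :=
  ∃ γ : ℝ → ℝ, γ 0 = x ∧ γ 1 = y ∧ (∀ t ∈ Icc (0 : ℝ) 1, γ t ∈ V) ∧
    IsIntegralCurveOn γ (fun _ => h) (Icc 0 1)

theorem timeOneMapOn_iff (u P : ℝ → ℝ) (V : Set ℝ) :
    TimeOneMapOn u P V ↔ ∀ x ∈ V, P x ∈ V → FlowsTo u V x (P x) := Iff.rfl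

theorem FlowsTo.mono {h : ℝ → ℝ} {V W : Set ℝ} {x y : ℝ} (hxy : FlowsTo h V x y) (hVW : V ⊆ W) :
    FlowsTo h W x y := by
  obtain ⟨γ, h0, h1, hV, hγ⟩ := hxy
  exact ⟨γ, h0, h1, fun t ht => hVW (hV t ht), hγ⟩

theorem FlowsTo.reflect {h : ℝ → ℝ} {V W : Set ℝ} {x y : ℝ} (hxy : FlowsTo h V x y)
    (hVW : ∀ z ∈ V, -z ∈ W) : FlowsTo (reflectField h) W (-x) (-y) := by
  obtain ⟨γ, h0, h1, hV, hγ⟩ := hxy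
  refine ⟨-γ, by rw [Pi.neg_apply, h0], by rw [Pi.neg_apply, h1],
    fun t ht => hVW _ (hV t ht), fun t ht => ?_⟩
  simpa [reflectField] using (hγ t ht).neg

/-- The constant curve solves the same equation. The image of `γ` lies in a compact interval inside
`V`, where `u` is Lipschitz, so uniqueness applies forward and backward from `t₀`. -/
theorem IsIntegralCurveOn.eq_of_zero {u γ : ℝ → ℝ} {V : Set ℝ}
    (hVc : V.OrdConnected) (hu : ContDiffOn ℝ ∞ u V) (hγV : ∀ t ∈ Icc (0 : ℝ) 1, γ t ∈ V)
    (hγ : IsIntegralCurveOn γ (fun _ => u) (Icc 0 1)) {t₀ : ℝ} (ht₀ : t₀ ∈ Icc (0 : ℝ) 1)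
    (h0 : u (γ t₀) = 0) : ∀ t ∈ Icc (0 : ℝ) 1, γ t = γ t₀ := by
  have hc := hγ.continuousOn
  obtain ⟨t₁, ht₁, hm⟩ := isCompact_Icc.exists_isMinOn ⟨t₀, ht₀⟩ hc
  obtain ⟨t₂, ht₂, hM⟩ := isCompact_Icc.exists_isMaxOn ⟨t₀, ht₀⟩ hc
  have hsub : Icc (γ t₁) (γ t₂) ⊆ V := hVc.out (hγV _ ht₁) (hγV _ ht₂)
  have hmem : ∀ t ∈ Icc (0 : ℝ) 1, γ t ∈ Icc (γ t₁) (γ t₂) := fun t ht => ⟨hm ht, hM ht⟩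
  obtain ⟨K, hK⟩ : ∃ K, LipschitzOnWith K u (Icc (γ t₁) (γ t₂)) :=
    (((hu.mono hsub).of_le (by exact_mod_cast le_top :
      (1 : WithTop ℕ∞) ≤ ∞)).exists_lipschitzOnWith one_ne_zero (convex_Icc _ _) isCompact_Icc)
  have e1 : EqOn γ (fun _ => γ t₀) (Icc t₀ 1) := by
    have hs : Icc t₀ 1 ⊆ Icc (0 : ℝ) 1 := Icc_subset_Icc_left ht₀.1
    refine ODE_solution_unique_of_mem_Icc_right (v := fun _ => u)
      (s := fun _ => Icc (γ t₁) (γ t₂)) (fun t _ => hK) (hc.mono hs) (fun t ht => ?_)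
      (fun t ht => hmem t (hs (Ico_subset_Icc_self ht))) continuousOn_const (fun t _ => ?_)
      (fun t _ => hmem t₀ ht₀) rfl
    · exact ((hγ t (hs (Ico_subset_Icc_self ht))).mono
        (Icc_subset_Icc_left (ht₀.1.trans ht.1))).mono_of_mem_nhdsWithin (Icc_mem_nhdsGE ht.2)
    · simp only [h0]
      exact hasDerivWithinAt_const _ _ _
  have e2 : EqOn γ (fun _ => γ t₀) (Icc 0 t₀) := by
    have hs : Icc 0 t₀ ⊆ Icc (0 : ℝ) 1 := Icc_subset_Icc_right ht₀.2
    refine ODE_solution_unique_of_mem_Icc_left (v := fun _ => u)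
      (s := fun _ => Icc (γ t₁) (γ t₂)) (fun t _ => hK) (hc.mono hs) (fun t ht => ?_)
      (fun t ht => hmem t (hs (Ioc_subset_Icc_self ht))) continuousOn_const (fun t _ => ?_)
      (fun t _ => hmem t₀ ht₀) rfl
    · exact ((hγ t (hs (Ioc_subset_Icc_self ht))).mono
        (Icc_subset_Icc_right (ht.2.trans ht₀.2))).mono_of_mem_nhdsWithin (Icc_mem_nhdsLE ht.1)
    · simp only [h0]
      exact hasDerivWithinAt_const _ _ _
  intro t ht
  rcases le_total t t₀ with h | h
  · exact e2 ⟨ht.1, h⟩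
  · exact e1 ⟨h, ht.2⟩

theorem FlowsTo.time_eq {h F : ℝ → ℝ} {I : Set ℝ} (h0 : ∀ y ∈ I, h y ≠ 0)
    (hF : ∀ y ∈ I, HasDerivAt F (h y)⁻¹ y) {x y : ℝ} (hxy : FlowsTo h I x y) : F y = F x + 1 := by
  obtain ⟨γ, rfl, rfl, hγI, hγ⟩ := hxy
  have hd : ∀ t ∈ Icc (0 : ℝ) 1, HasDerivWithinAt (fun t => F (γ t) - t) 0 (Icc 0 1) t := by
    intro t ht
    have := ((hF _ (hγI t ht)).comp_hasDerivWithinAt t (hγ t ht)).sub (hasDerivWithinAt_id t _)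
    refine this.congr_deriv ?_
    rw [inv_mul_cancel₀ (h0 _ (hγI t ht)), sub_self]
  have := constant_of_has_deriv_right_zero (fun t ht => (hd t ht).continuousWithinAt)
    (fun t ht => (hd t (Ico_subset_Icc_self ht)).mono_of_mem_nhdsWithin
      (mem_of_superset (Icc_mem_nhdsGE ht.2) (Icc_subset_Icc_left ht.1))) 1 ⟨zero_le_one, le_rfl⟩
  simp only [sub_zero] at this
  linarith

theorem exists_time_function {h : ℝ → ℝ} {p q : ℝ} (hpq : p < q) (hc : ContinuousOn h (Ioo p q))
    (h0 : ∀ y ∈ Ioo p q, h y ≠ 0) : ∃ F : ℝ → ℝ, ∀ y ∈ Ioo p q, HasDerivAt F (h y)⁻¹ y := by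
  obtain ⟨x, hx⟩ := nonempty_Ioo.2 hpq
  have hc' : ContinuousOn (fun y => (h y)⁻¹) (Ioo p q) := hc.inv₀ h0
  refine ⟨fun y => ∫ z in x..y, (h z)⁻¹, fun y hy => ?_⟩
  have hsub : uIcc x y ⊆ Ioo p q := ordConnected_Ioo.uIcc_subset hx hy
  exact intervalIntegral.integral_hasDerivAt_right (hc'.mono hsub).intervalIntegrable
    (hc'.stronglyMeasurableAtFilter isOpen_Ioo y hy) (hc'.continuousAt (isOpen_Ioo.mem_nhds hy))

/-- The curve is `t ↦ F⁻¹ (F x + t)`. It exists up to time `1` because these values lie between `F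
x` and `F y`. -/
theorem FlowsTo.of_time_eq {h F : ℝ → ℝ} {p q : ℝ} (hc : ContinuousOn h (Ioo p q))
    (h0 : ∀ y ∈ Ioo p q, h y ≠ 0) (hF : ∀ y ∈ Ioo p q, HasDerivAt F (h y)⁻¹ y) {x y : ℝ}
    (hx : x ∈ Ioo p q) (hy : y ∈ Ioo p q) (hxy : F y = F x + 1) : FlowsTo h (Ioo p q) x y := by
  have hinj : InjOn F (Ioo p q) := by
    have key : ∀ c ∈ Ioo p q, ∀ d ∈ Ioo p q, c < d → F c ≠ F d := by
      intro c hcm d hdm hcd heq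
      have hsub : Icc c d ⊆ Ioo p q := Icc_subset_Ioo hcm.1 hdm.2
      obtain ⟨ξ, hξ, hξ0⟩ := exists_hasDerivAt_eq_zero hcd
        (fun z hz => (hF z (hsub hz)).continuousAt.continuousWithinAt) heq
        fun z hz => hF z (hsub (Ioo_subset_Icc_self hz))
      exact inv_ne_zero (h0 ξ (hsub (Ioo_subset_Icc_self hξ))) hξ0
    intro c hcm d hdm heq
    by_contra hne
    rcases lt_or_gt_of_ne hne with hlt | hlt
    · exact key c hcm d hdm hlt heq
    · exact key d hdm c hcm hlt heq.symm
  have hsub : uIcc x y ⊆ Ioo p q := ordConnected_Ioo.uIcc_subset hx hy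
  have hex : ∀ t ∈ Icc (0 : ℝ) 1, ∃ z ∈ Ioo p q, F z = F x + t := by
    intro t ht
    obtain ⟨z, hz, hzt⟩ := intermediate_value_uIcc
      (fun z hz => (hF z (hsub hz)).continuousAt.continuousWithinAt)
      (show F x + t ∈ uIcc (F x) (F y) by
        rw [hxy, uIcc_of_le (by linarith)]; exact ⟨by linarith [ht.1], by linarith [ht.2]⟩)
    exact ⟨z, hsub hz, hzt⟩
  choose! γ hγI hγF using hex
  have h01 : (0 : ℝ) ∈ Icc (0 : ℝ) 1 := ⟨le_rfl, zero_le_one⟩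
  have h11 : (1 : ℝ) ∈ Icc (0 : ℝ) 1 := ⟨zero_le_one, le_rfl⟩
  refine ⟨γ, hinj (hγI 0 h01) hx (by simp [hγF 0 h01]), hinj (hγI 1 h11) hy (by rw [hγF 1 h11, hxy]),
    hγI, fun t ht => ?_⟩
  have hz := hγI t ht
  have hs : HasStrictDerivAt F (h (γ t))⁻¹ (γ t) := by
    refine hasStrictDerivAt_of_hasDerivAt_of_continuousAt (f' := fun z => (h z)⁻¹) ?_
      ((hc.inv₀ h0).continuousAt (isOpen_Ioo.mem_nhds hz))
    filter_upwards [isOpen_Ioo.mem_nhds hz] with z hz using hF z hz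
  have hne := inv_ne_zero (h0 _ hz)
  -- `γ` was chosen pointwise; injectivity of `F` identifies it near `t` with the differentiable
  -- local inverse.
  set g := hs.localInverse F _ _ hne
  have hg : HasDerivAt g (h (γ t)) (F (γ t)) := by
    have := (hs.to_localInverse hne).hasDerivAt
    rwa [inv_inv] at this
  have hgz : g (F (γ t)) = γ t :=
    (hs.hasStrictFDerivAt_equiv hne).localInverse_apply_image
  rw [hγF t ht] at hg hgz
  have h2 : HasDerivAt (fun s => g (F x + s)) (h (γ t)) t := by
    have := hg.comp_const_add (F x) t
    exact this
  refine h2.hasDerivWithinAt.congr_of_eventuallyEq_of_mem ?_ ht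
  have hF1 : ∀ᶠ s in 𝓝 t, F (g (F x + s)) = F x + s := by
    have h3 := (hs.hasStrictFDerivAt_equiv hne).eventually_right_inverse
    rw [hγF t ht] at h3
    exact ((continuous_const_add (F x)).tendsto t).eventually h3
  have hg1 : ∀ᶠ s in 𝓝 t, g (F x + s) ∈ Ioo p q := by
    refine h2.continuousAt.eventually_mem ?_
    rw [hgz]
    exact isOpen_Ioo.mem_nhds hz
  filter_upwards [nhdsWithin_le_nhds hF1, nhdsWithin_le_nhds hg1, self_mem_nhdsWithin]
    with s hs1 hs2 hs3
  exact hinj (hγI s hs3) hs2 (by rw [hs1, hγF s hs3])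

/-! ### Invariance under `R` versus being a flow through `R`. -/

namespace ParabolicContraction

variable {R : ℝ → ℝ} {c b : ℝ}

/-- A vector field with time-one map `R`, or `R⁻¹`, is invariant under `R`. -/
theorem invariant_of_flowsTo (hR : ParabolicContraction R c b) {h : ℝ → ℝ}
    (hs : ContDiffOn ℝ ∞ h (Ioo (-b) b)) (hz : h 0 = 0)
    (hflow : (∀ s ∈ Ioo 0 b, FlowsTo h (Ioo (-b) b) s (R s)) ∨
      ∀ s ∈ Ioo 0 b, FlowsTo h (Ioo (-b) b) (R s) s) {s : ℝ} (hsm : s ∈ Ioo 0 b) :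
    h (R s) = deriv R s * h s := by
  have hb := hR.b_pos
  have hsub : Ioo 0 b ⊆ Ioo (-b) b := Ioo_subset_Ioo_left (by linarith)
  -- A flow line with an endpoint at a zero is constant; as `R s < s`, the field has no zero in `(0,
  -- b)`.
  have hconst : ∀ {x y : ℝ}, FlowsTo h (Ioo (-b) b) x y → ∀ z, h z = 0 → (z = x ∨ z = y) → x = y := by
    rintro x y ⟨γ, rfl, rfl, hV, hγ⟩ z hz hzz
    have h01 : (0 : ℝ) ∈ Icc (0 : ℝ) 1 := ⟨le_rfl, zero_le_one⟩
    have h11 : (1 : ℝ) ∈ Icc (0 : ℝ) 1 := ⟨zero_le_one, le_rfl⟩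
    rcases hzz with rfl | rfl
    · exact (hγ.eq_of_zero ordConnected_Ioo hs hV h01 hz 1 h11).symm
    · exact hγ.eq_of_zero ordConnected_Ioo hs hV h11 hz 0 h01
  have hne : ∀ s ∈ Ioo 0 b, h s ≠ 0 := by
    intro s hs' h0
    have hlt := hR.map_lt (Ioo_subset_Ioc_self hs')
    rcases hflow with hf | hf
    · exact hlt.ne' (hconst (hf s hs') s h0 (Or.inl rfl))
    · exact hlt.ne (hconst (hf s hs') s h0 (Or.inr rfl))
  -- A curve starting to the right of `0` cannot reach `0`, a rest point, so it stays where the time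
  -- function is defined.
  have hpos : ∀ {x y : ℝ}, 0 < x → FlowsTo h (Ioo (-b) b) x y → FlowsTo h (Ioo 0 b) x y := by
    rintro x y hx ⟨γ, rfl, rfl, hV, hγ⟩
    refine ⟨γ, rfl, rfl, fun t ht => ⟨?_, (hV t ht).2⟩, hγ⟩
    by_contra hcon
    push Not at hcon
    obtain ⟨t₀, ht₀, h0⟩ := intermediate_value_Icc' ht.1
      (hγ.continuousOn.mono (Icc_subset_Icc_right ht.2)) (show (0 : ℝ) ∈ Icc (γ t) (γ 0) from
        ⟨hcon, hx.le⟩)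
    have := hγ.eq_of_zero ordConnected_Ioo hs hV ⟨ht₀.1, ht₀.2.trans ht.2⟩
      (by rw [h0, hz]) 0 ⟨le_rfl, zero_le_one⟩
    rw [h0] at this
    exact hx.ne' this
  obtain ⟨F, hF⟩ := exists_time_function hb (hs.continuousOn.mono hsub) hne
  -- Differentiating `F (R s) = F s + σ` gives `R' s / h (R s) = 1 / h s`, which is invariance.
  obtain ⟨σ, hσ⟩ : ∃ σ, ∀ s ∈ Ioo 0 b, F (R s) = F s + σ := by
    rcases hflow with hf | hf
    · exact ⟨1, fun s hs' => (hpos hs'.1 (hf s hs')).time_eq hne hF⟩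
    · exact ⟨-1, fun s hs' => by
        have := (hpos (hR.mapsTo_Ioo hs').1 (hf s hs')).time_eq hne hF
        linarith⟩
  have hRs := hR.mapsTo_Ioo hsm
  have d1 := (hF _ hRs).comp s (hR.hasDerivAt (Ioo_subset_Icc_self hsm))
  have d2 : HasDerivAt (F ∘ R) (h s)⁻¹ s := by
    refine ((hF s hsm).add_const σ).congr_of_eventuallyEq ?_
    filter_upwards [isOpen_Ioo.mem_nhds hsm] with z hz' using hσ z hz'
  have e := d1.unique d2
  have := hne _ hRs
  have := hne _ hsm
  field_simp at e
  linarith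

/-- The time function of an invariant vector field is translated by `R`. -/
theorem time_translation (hR : ParabolicContraction R c b) {h F : ℝ → ℝ} {r a : ℝ} (ha : a ≠ 0)
    (hinv : ∀ x ∈ Ioo 0 b, h (R x) = deriv R x * h x) (h0 : ∀ x ∈ Ioo 0 b, h x ≠ 0)
    (hF : ∀ x ∈ Ioo 0 b, HasDerivAt F (h x)⁻¹ x)
    (hha : Tendsto (fun x => h x / x ^ 2) (𝓝[>] 0) (𝓝 a))
    (hRr : Tendsto (fun x => (R x - x) / x ^ 2) (𝓝[>] 0) (𝓝 r)) {x : ℝ} (hx : x ∈ Ioo 0 b) :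
    F (R x) = F x + r / a := by
  have hn : Ioo 0 b ∈ 𝓝[>] (0 : ℝ) := Ioo_mem_nhdsGT hR.b_pos
  have hconst : ∀ y ∈ Ioo 0 b, F (R y) - F y = F (R x) - F x := by
    intro y hy
    have hd : ∀ z ∈ Ioo 0 b, HasDerivAt (fun z => F (R z) - F z) 0 z := by
      intro z hz
      have hRz := hR.mapsTo_Ioo hz
      have := ((hF _ hRz).comp z (hR.hasDerivAt (Ioo_subset_Icc_self hz))).sub (hF z hz)
      refine this.congr_deriv ?_
      rw [hinv z hz, mul_inv, mul_right_comm,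
        inv_mul_cancel₀ (hR.deriv_pos (Ioo_subset_Icc_self hz)).ne', one_mul, sub_self]
    exact isOpen_Ioo.is_const_of_deriv_eq_zero isPreconnected_Ioo
      (fun z hz => (hd z hz).differentiableAt.differentiableWithinAt)
      (fun z hz => (hd z hz).deriv) hy hx
  -- The constant `F (R y) - F y` equals `(R y - y) / h ξ` with `ξ` between `R y` and `y`. As `y →
  -- 0` the ratio `ξ / y` is squeezed to `1`, so the quotient tends to `r / a`.
  have hmv : ∀ y ∈ Ioo 0 b, ∃ ξ ∈ Ioo (R y) y, F (R y) - F y = (R y - y) * (h ξ)⁻¹ := by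
    intro y hy
    have hsub : Icc (R y) y ⊆ Ioo 0 b := Icc_subset_Ioo (hR.mapsTo_Ioo hy).1 hy.2
    obtain ⟨ξ, hξ, he⟩ := exists_hasDerivAt_eq_slope F (fun z => (h z)⁻¹)
      (hR.map_lt (Ioo_subset_Ioc_self hy))
      (fun z hz => (hF z (hsub hz)).continuousAt.continuousWithinAt)
      fun z hz => hF z (hsub (Ioo_subset_Icc_self hz))
    refine ⟨ξ, hξ, ?_⟩
    have : y - R y ≠ 0 := (sub_pos.2 (hR.map_lt (Ioo_subset_Ioc_self hy))).ne'
    rw [eq_div_iff this] at he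
    linarith
  choose! ξ hξ hξe using hmv
  have hid : Tendsto (fun y : ℝ => y) (𝓝[>] 0) (𝓝 0) := tendsto_id.mono_left nhdsWithin_le_nhds
  have hξ0 : Tendsto ξ (𝓝[>] 0) (𝓝[>] 0) := by
    refine tendsto_nhdsWithin_iff.2 ⟨?_, ?_⟩
    · refine tendsto_of_tendsto_of_tendsto_of_le_of_le' tendsto_const_nhds hid ?_ ?_
      · filter_upwards [hn] with y hy using ((hR.mapsTo_Ioo hy).1.trans (hξ y hy).1).le
      · filter_upwards [hn] with y hy using (hξ y hy).2.le
    · filter_upwards [hn] with y hy using (hR.mapsTo_Ioo hy).1.trans (hξ y hy).1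
  have hratio : Tendsto (fun y => ξ y / y) (𝓝[>] 0) (𝓝 1) := by
    have h1 : Tendsto (fun y => 1 + (R y - y) / y ^ 2 * y) (𝓝[>] 0) (𝓝 1) := by
      simpa using (hRr.mul hid).const_add 1
    refine tendsto_of_tendsto_of_tendsto_of_le_of_le' h1 tendsto_const_nhds ?_ ?_
    · filter_upwards [hn] with y hy
      have hy0 := hy.1
      have e : 1 + (R y - y) / y ^ 2 * y = R y / y := by field_simp; ring
      rw [e]
      gcongr
      exact (hξ y hy).1.le
    · filter_upwards [hn] with y hy
      exact (div_le_one hy.1).2 (hξ y hy).2.le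
  have hlim : Tendsto (fun y => (R y - y) / y ^ 2 * ((ξ y / y) ^ 2)⁻¹ * (h (ξ y) / ξ y ^ 2)⁻¹)
      (𝓝[>] 0) (𝓝 (r / a)) := by
    have := (hRr.mul ((hratio.pow 2).inv₀ (by norm_num))).mul ((hha.comp hξ0).inv₀ ha)
    simpa [div_eq_mul_inv] using this
  have hlim2 : Tendsto (fun y => (R y - y) / y ^ 2 * ((ξ y / y) ^ 2)⁻¹ * (h (ξ y) / ξ y ^ 2)⁻¹)
      (𝓝[>] 0) (𝓝 (F (R x) - F x)) := by
    refine tendsto_const_nhds.congr' ?_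
    filter_upwards [hn] with y hy
    rw [← hconst y hy, hξe y hy]
    have hξp : 0 < ξ y := (hR.mapsTo_Ioo hy).1.trans (hξ y hy).1
    have := h0 (ξ y) ⟨hξp, (hξ y hy).2.trans hy.2⟩
    have := hy.1.ne'
    have := hξp.ne'
    field_simp
  have := tendsto_nhds_unique hlim hlim2
  linarith

/-- An invariant vector field whose leading coefficient is that of `R`, up to sign, has time-one map
`R` or `R⁻¹`. -/
theorem flowsTo_of_invariant (hR : ParabolicContraction R c b) {h : ℝ → ℝ} {r a : ℝ} (ha : a ≠ 0)
    (hc : ContinuousOn h (Ioo 0 b)) (hinv : ∀ x ∈ Ioo 0 b, h (R x) = deriv R x * h x)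
    (hha : Tendsto (fun x => h x / x ^ 2) (𝓝[>] 0) (𝓝 a))
    (hRr : Tendsto (fun x => (R x - x) / x ^ 2) (𝓝[>] 0) (𝓝 r)) {x : ℝ} (hx : x ∈ Ioo 0 b) :
    (r = a → FlowsTo h (Ioo 0 b) x (R x)) ∧ (r = -a → FlowsTo h (Ioo 0 b) (R x) x) := by
  have h0 : ∀ x ∈ Ioo 0 b, h x ≠ 0 := fun x hx => hR.ne_zero_of_invariant ha hinv hha hx
  obtain ⟨F, hF⟩ := exists_time_function hR.b_pos hc h0
  have ht := hR.time_translation ha hinv h0 hF hha hRr hx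
  refine ⟨fun hr => ?_, fun hr => ?_⟩
  · exact FlowsTo.of_time_eq hc h0 hF hx (hR.mapsTo_Ioo hx) (by rw [ht, hr, div_self ha])
  · refine FlowsTo.of_time_eq hc h0 hF (hR.mapsTo_Ioo hx) hx ?_
    rw [ht, hr, neg_div, div_self ha]
    ring

end ParabolicContraction

/-! ### Existence, uniqueness and continuity of the generator. -/

theorem tendsto_div_sq_of_isBigO {f : ℝ → ℝ} {a : ℝ}
    (h : (fun x => f x - a * x ^ 2) =O[𝓝 0] fun x => x ^ 3) :
    Tendsto (fun x => f x / x ^ 2) (𝓝[≠] 0) (𝓝 a) := by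
  have h1 : (fun x => f x - a * x ^ 2) =o[𝓝[≠] 0] fun x => x ^ 2 :=
    (h.trans_isLittleO (Asymptotics.isLittleO_pow_pow (by norm_num))).mono nhdsWithin_le_nhds
  have h2 := h1.tendsto_div_nhds_zero.add_const a
  rw [zero_add] at h2
  refine h2.congr' ?_
  filter_upwards [self_mem_nhdsWithin] with x hx
  have : x ≠ 0 := hx
  field_simp
  ring

theorem tendsto_div_sq_of_contDiffAt {f : ℝ → ℝ} (hf : ContDiffAt ℝ ∞ f 0) (h0 : f 0 = 0)
    (h1 : deriv f 0 = 0) :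
    Tendsto (fun x => f x / x ^ 2) (𝓝[≠] 0) (𝓝 (iteratedDeriv 2 f 0 / 2)) := by
  refine tendsto_div_sq_of_isBigO ?_
  have := isBigO_sub_leading hf (N := 2) fun j hj => by
    interval_cases j
    · simpa using h0
    · simpa using h1
  simpa using this

theorem tendsto_reflectField_div_sq {f : ℝ → ℝ} {a : ℝ}
    (h : Tendsto (fun x => f x / x ^ 2) (𝓝[≠] 0) (𝓝 a)) :
    Tendsto (fun x => reflectField f x / x ^ 2) (𝓝[>] 0) (𝓝 (-a)) := by
  have h1 : Tendsto (fun x : ℝ => -x) (𝓝[>] 0) (𝓝[≠] 0) := by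
    have : Tendsto (fun x : ℝ => -x) (𝓝[>] 0) (𝓝[<] 0) := by
      simpa using tendsto_neg_nhdsGT (a := (0 : ℝ))
    exact this.mono_right (nhdsWithin_mono _ fun _ (hx : _ < 0) => hx.ne)
  refine (h.comp h1).neg.congr fun x => ?_
  simp [reflectField, neg_div]

theorem reflectField_reflectField (w : ℝ → ℝ) : reflectField (reflectField w) = w := by
  ext x; simp [reflectField]

namespace ParabolicExpansion

variable {Q : ℝ → ℝ} {α A B M b : ℝ}

theorem Ioo_mem_nhds_zero (h : ParabolicExpansion Q α A B M b) : Ioo (-b) b ∈ 𝓝 (0 : ℝ) :=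
  Ioo_mem_nhds h.zero_mem.1 h.zero_mem.2

theorem deriv_zero (h : ParabolicExpansion Q α A B M b) : deriv Q 0 = 1 := by
  have := h.deriv_expansion 0 (Ioo_subset_Icc_self h.zero_mem)
  simp at this
  linarith

theorem tendsto_sub_div_sq (h : ParabolicExpansion Q α A B M b) :
    Tendsto (fun x => (Q x - x) / x ^ 2) (𝓝[≠] 0) (𝓝 (-A)) :=
  tendsto_div_sq_of_isBigO (h.isBigO_expansion.1.congr_left fun x => by ring)

theorem exists_reflectedInverse_eq (h : ParabolicExpansion Q α A B M b) {s : ℝ}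
    (hs : s ∈ Icc 0 b) : ∃ t ∈ Icc 0 b, -t ∈ Ioo (-b) b ∧ -Q (-t) = s ∧
      reflectedInverse Q b s = t ∧ deriv (reflectedInverse Q b) s = (deriv Q (-t))⁻¹ := by
  obtain ⟨t, ht, htb, rfl⟩ := h.exists_neg_map_neg_eq hs
  refine ⟨t, ht, htb, rfl, ?_, (h.hasDerivAt_reflectedInverse htb).deriv⟩
  rw [h.reflectedInverse_apply (Ioo_subset_Icc_self htb), neg_neg]

/-- With `t = L s` and `Q (-t) = -s`, the difference `L s - s` is `Q (-t) - (-t)`. The coefficient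
is therefore that of `Q`, times the limit `1` of `(L s / s) ^ 2`. -/
theorem tendsto_reflectedInverse_sub_div_sq (h : ParabolicExpansion Q α A B M b) :
    Tendsto (fun s => (reflectedInverse Q b s - s) / s ^ 2) (𝓝[>] 0) (𝓝 (-A)) := by
  set L := reflectedInverse Q b with hL
  have hn : Ioo 0 b ∈ 𝓝[>] (0 : ℝ) := Ioo_mem_nhdsGT h.b_pos
  have hc : ParabolicContraction L (α / 4) b := h.leftContraction
  have hd : HasDerivAt L 1 0 := by
    have := h.hasDerivAt_reflectedInverse h.zero_mem
    rwa [h.deriv_zero, inv_one, h.map_zero, neg_zero] at this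
  have hratio : Tendsto (fun s => L s / s) (𝓝[>] 0) (𝓝 1) := by
    have := hd.tendsto_slope.mono_left (nhdsGT_le_nhdsNE 0)
    refine this.congr fun s => ?_
    rw [slope_def_field, hc.map_zero, sub_zero, sub_zero]
  have hL0 : Tendsto (fun s => -L s) (𝓝[>] 0) (𝓝[≠] 0) := by
    refine tendsto_nhdsWithin_iff.2 ⟨?_, ?_⟩
    · have := hd.continuousAt.tendsto.neg
      rw [hc.map_zero, neg_zero] at this
      exact this.mono_left nhdsWithin_le_nhds
    · filter_upwards [hn] with s hs
      exact (neg_neg_of_pos (hc.mapsTo_Ioo hs).1).ne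
  have h1 := (h.tendsto_sub_div_sq.comp hL0).mul (hratio.pow 2)
  rw [one_pow, mul_one] at h1
  refine h1.congr' ?_
  filter_upwards [hn] with s hs
  obtain ⟨t, ht, htb, h2, h3, -⟩ := h.exists_reflectedInverse_eq (Ioo_subset_Icc_self hs)
  have ht0 : t ≠ 0 := by rw [← h3]; exact (hc.mapsTo_Ioo hs).1.ne'
  have hs0 := hs.1.ne'
  simp only [Function.comp_apply, hL, h3]
  rw [show Q (-t) = -s by linarith]
  field_simp
  ring

theorem contDiffAt_invariantField (h : ParabolicExpansion Q α A B M b) :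
    ContDiffAt ℝ ∞ (invariantField Q A B b) 0 :=
  h.contDiffOn_invariantField.contDiffAt h.Ioo_mem_nhds_zero

theorem tendsto_invariantField_div_sq (h : ParabolicExpansion Q α A B M b) :
    Tendsto (fun x => invariantField Q A B b x / x ^ 2) (𝓝[≠] 0) (𝓝 (-A)) := by
  have := tendsto_div_sq_of_contDiffAt h.contDiffAt_invariantField h.invariantField_zero
    h.deriv_invariantField
  rwa [h.iteratedDeriv_invariantField (by norm_num), iteratedDeriv_two_cubicField, neg_mul,
    neg_div, mul_div_cancel_left₀ _ (two_ne_zero)] at this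

theorem contDiffOn_reflectField {v : ℝ → ℝ} (hv : ContDiffOn ℝ ∞ v (Ioo (-b) b)) :
    ContDiffOn ℝ ∞ (reflectField v) (Ioo (-b) b) :=
  (hv.comp contDiff_neg.contDiffOn fun x hx => ⟨by linarith [hx.2], by linarith [hx.1]⟩).neg

theorem isGeneratorOn_invariantField (h : ParabolicExpansion Q α A B M b)
    (h2 : iteratedDeriv 2 Q 0 = -2 * A) :
    IsGeneratorOn (invariantField Q A B b) Q (Ioo (-b) b) := by
  have hb := h.b_pos
  have hA : -A ≠ 0 := neg_ne_zero.2 h.A_pos.ne'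
  have hsm := h.contDiffOn_invariantField
  have hsub : Ioo 0 b ⊆ Ioo (-b) b := Ioo_subset_Ioo_left (by linarith)
  refine ⟨hsm, h.invariantField_zero, h.deriv_invariantField, ?_, ?_⟩
  · rw [h.iteratedDeriv_invariantField (by norm_num), iteratedDeriv_two_cubicField, h2]
  rw [timeOneMapOn_iff]
  intro x hx hQx
  rcases lt_trichotomy x 0 with h0 | rfl | h0
  · have hs : -Q x ∈ Ioo 0 b := by
      refine ⟨?_, by linarith [hQx.1]⟩
      have := h.strictMonoOn (Ioo_subset_Icc_self hx) (Ioo_subset_Icc_self h.zero_mem) h0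
      rw [h.map_zero] at this
      linarith
    -- The reflected field has leading coefficient `A`, opposite to that of `L s - s`, so it flows
    -- from `L s` to `s`. With `s = -Q x` this is the flow from `-x` to `-Q x`.
    have h3 := (h.leftContraction.flowsTo_of_invariant (neg_ne_zero.2 hA)
      ((contDiffOn_reflectField hsm).continuousOn.mono hsub) (fun s hs => h.invariantField_left hs)
      (tendsto_reflectField_div_sq h.tendsto_invariantField_div_sq)
      h.tendsto_reflectedInverse_sub_div_sq hs).2 (neg_neg _).symm
    rw [h.reflectedInverse_apply (Ioo_subset_Icc_self hx)] at h3
    have h4 := h3.reflect (W := Ioo (-b) b) fun z hz => ⟨by linarith [hz.2], by linarith [hz.1]⟩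
    rwa [neg_neg, neg_neg, reflectField_reflectField] at h4
  · refine ⟨fun _ => 0, rfl, h.map_zero.symm, fun _ _ => hx, fun t _ => ?_⟩
    simp only [h.invariantField_zero]
    exact hasDerivWithinAt_const _ _ _
  · exact ((h.rightContraction.flowsTo_of_invariant hA (hsm.continuousOn.mono hsub)
      (fun s hs => h.invariantField_right hs)
      (h.tendsto_invariantField_div_sq.mono_left (nhdsGT_le_nhdsNE 0))
      (h.tendsto_sub_div_sq.mono_left (nhdsGT_le_nhdsNE 0)) ⟨h0, hx.2⟩).1 rfl).mono hsub

/-- Uniqueness of the generator. -/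
theorem eq_invariantField (h : ParabolicExpansion Q α A B M b)
    (h2 : iteratedDeriv 2 Q 0 = -2 * A) {v : ℝ → ℝ} (hv : IsGeneratorOn v Q (Ioo (-b) b)) {x : ℝ}
    (hx : x ∈ Ioo (-b) b) : v x = invariantField Q A B b x := by
  have hb := h.b_pos
  have hA : -A ≠ 0 := neg_ne_zero.2 h.A_pos.ne'
  have hsub : Ioo 0 b ⊆ Ioo (-b) b := Ioo_subset_Ioo_left (by linarith)
  have hvA : Tendsto (fun x => v x / x ^ 2) (𝓝[≠] 0) (𝓝 (-A)) := by
    have := tendsto_div_sq_of_contDiffAt (hv.smooth.contDiffAt h.Ioo_mem_nhds_zero) hv.map_zero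
      hv.deriv_zero
    rwa [hv.deriv_two, h2, neg_mul, neg_div, mul_div_cancel_left₀ _ (two_ne_zero)] at this
  have hflow := (timeOneMapOn_iff _ _ _).1 hv.timeOne
  rcases lt_trichotomy x 0 with h0 | rfl | h0
  · have hR := h.leftContraction
    have hx' : -x ∈ Ioo 0 b := ⟨by linarith, by linarith [hx.1]⟩
    have hinv : ∀ s ∈ Ioo 0 b, reflectField v (reflectedInverse Q b s) =
        deriv (reflectedInverse Q b) s * reflectField v s := by
      intro s hs
      refine hR.invariant_of_flowsTo (contDiffOn_reflectField hv.smooth)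
        (by simp [reflectField, hv.map_zero]) (Or.inr fun s hs => ?_) hs
      obtain ⟨t, ht, htb, h3, h4, -⟩ := h.exists_reflectedInverse_eq (Ioo_subset_Icc_self hs)
      have h5 := (hflow (-t) htb (by
        rw [show Q (-t) = -s by linarith]
        exact ⟨by linarith [hs.2], by linarith [hs.1]⟩)).reflect (W := Ioo (-b) b)
          fun z hz => ⟨by linarith [hz.2], by linarith [hz.1]⟩
      rwa [neg_neg, h3, ← h4] at h5
    have := hR.eq_of_invariant (neg_ne_zero.2 hA) hinv (fun s hs => h.invariantField_left hs)
      (tendsto_reflectField_div_sq hvA)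
      (tendsto_reflectField_div_sq h.tendsto_invariantField_div_sq) hx'
    simpa [reflectField] using this
  · rw [hv.map_zero, h.invariantField_zero]
  · have hR := h.rightContraction
    refine hR.eq_of_invariant hA (fun s hs => ?_) (fun s hs => h.invariantField_right hs)
      (hvA.mono_left (nhdsGT_le_nhdsNE 0))
      (h.tendsto_invariantField_div_sq.mono_left (nhdsGT_le_nhdsNE 0)) ⟨h0, hx.2⟩
    exact hR.invariant_of_flowsTo hv.smooth hv.map_zero
      (Or.inl fun s hs => hflow s (hsub hs) (hsub (hR.mapsTo_Ioo hs))) hs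

theorem abs_sub_le_two_mul (h : ParabolicExpansion Q α A B M b) {x y : ℝ} (hx : x ∈ Icc (-b) b)
    (hy : y ∈ Icc (-b) b) : |x - y| ≤ 2 * |Q x - Q y| := by
  wlog hxy : x ≤ y generalizing x y
  · rw [abs_sub_comm, abs_sub_comm (Q x)]
    exact this hy hx (le_of_not_ge hxy)
  have h1 := (convex_Icc (-b) b).mul_sub_le_image_sub_of_le_deriv h.continuousOn
    (fun z hz => (h.hasDerivAt (interior_subset hz)).differentiableAt.differentiableWithinAt)
    (fun z hz => h.deriv_pos (interior_subset hz)) x hx y hy hxy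
  rw [abs_sub_comm, abs_of_nonneg (sub_nonneg.2 hxy), abs_sub_comm, abs_of_nonneg (by linarith)]
  linarith

/-- The invariant vector field depends continuously on the map. -/
theorem tendstoUniformlyOn_invariantField {ι : Type*} {l : Filter ι} {S : ι → ℝ → ℝ}
    {A' B' : ι → ℝ} (h : ParabolicExpansion Q α A B M b)
    (hS : ∀ i, ParabolicExpansion (S i) α (A' i) (B' i) M b)
    (hA : Tendsto A' l (𝓝 A)) (hB : Tendsto B' l (𝓝 B))
    (h0 : TendstoUniformlyOn S Q l (Icc (-b) b))
    (h1 : TendstoUniformlyOn (fun i => deriv (S i)) (deriv Q) l (Icc (-b) b)) :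
    TendstoUniformlyOn (fun i => invariantField (S i) (A' i) (B' i) b) (invariantField Q A B b) l
      (Ioo (-b) b) := by
  have hb := h.b_pos
  obtain ⟨K, hK0, hK⟩ := exists_pullback_cubicField_bound M
  have hsub : Icc 0 b ⊆ Icc (-b) b := Icc_subset_Icc_left (by linarith)
  have hcubic : TendstoUniformlyOn (fun i => cubicField (A' i) (B' i)) (cubicField A B) l
      (Icc (-b) b) := by
    have ht : Tendsto (fun i => |A - A' i| + |(B - A ^ 2) - (B' i - A' i ^ 2)|) l (𝓝 0) := by
      have := ((hA.const_sub A).abs).add (((hB.sub (hA.pow 2)).const_sub (B - A ^ 2)).abs)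
      simpa using this
    rw [Metric.tendstoUniformlyOn_iff]
    intro ε hε
    filter_upwards [ht.eventually (gt_mem_nhds hε)] with i hi x hx
    refine lt_of_le_of_lt ?_ hi
    have hx1 := (h.abs_mul_le hx).2.2
    have e : cubicField A B x - cubicField (A' i) (B' i) x =
        -((A - A' i) * x ^ 2) + ((B - A ^ 2) - (B' i - A' i ^ 2)) * x ^ 3 := by
      simp only [cubicField]; ring
    rw [Real.dist_eq, e]
    refine (abs_add_le _ _).trans ?_
    rw [abs_neg, abs_mul, abs_mul, abs_pow, abs_pow]
    exact add_le_add (mul_le_of_le_one_right (abs_nonneg _) (pow_le_one₀ (abs_nonneg _) hx1))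
      (mul_le_of_le_one_right (abs_nonneg _) (pow_le_one₀ (abs_nonneg _) hx1))
  have hcc : Continuous (cubicField A B) := by unfold cubicField; fun_prop
  have hdc : ContinuousOn (deriv Q) (Icc (-b) b) := fun x hx =>
    (h.smooth x hx).deriv_infty.continuousAt.continuousWithinAt
  have hRight := tendstoUniformlyOn_pullbackLim (fun i => (hS i).rightContraction)
    h.rightContraction (hdc.mono hsub) (h0.mono hsub) (h1.mono hsub) hcc.continuousOn
    (hcubic.mono hsub) hK0 (fun i => (hK (hS i)).1) (hK h).1
  -- The preimages satisfy `Q (-t) = S i (-t')`, so `|t - t'|` is at most twice the distance of `Q`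
  -- and `S i` at `-t'`, because `Q' ≥ 1 / 2`.
  have hL0 : ∀ ε > 0, ∀ᶠ i in l, ∀ s ∈ Icc 0 b,
      dist (reflectedInverse Q b s) (reflectedInverse (S i) b s) < ε := by
    intro ε hε
    filter_upwards [Metric.tendstoUniformlyOn_iff.1 h0 (ε / 2) (by positivity)] with i hi s hs
    obtain ⟨t, -, htb, h3, h4, -⟩ := h.exists_reflectedInverse_eq hs
    obtain ⟨t', -, htb', h3', h4', -⟩ := (hS i).exists_reflectedInverse_eq hs
    rw [h4, h4', Real.dist_eq]
    have e1 := h.abs_sub_le_two_mul (Ioo_subset_Icc_self htb') (Ioo_subset_Icc_self htb)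
    have e2 := hi (-t') (Ioo_subset_Icc_self htb')
    rw [Real.dist_eq] at e2
    rw [show Q (-t) = S i (-t') by linarith] at e1
    rw [show t - t' = -t' - -t by ring]
    linarith
  have hL1 : TendstoUniformlyOn (fun i => deriv (reflectedInverse (S i) b))
      (deriv (reflectedInverse Q b)) l (Icc 0 b) := by
    rw [Metric.tendstoUniformlyOn_iff]
    intro ε hε
    have huc := isCompact_Icc.uniformContinuousOn_of_continuous hdc
    rw [Metric.uniformContinuousOn_iff] at huc
    obtain ⟨η, hη, hηQ⟩ := huc (ε / 8) (by positivity)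
    filter_upwards [Metric.tendstoUniformlyOn_iff.1 h1 (ε / 8) (by positivity), hL0 η hη]
      with i hi hi' s hs
    obtain ⟨t, -, htb, -, h4, h5⟩ := h.exists_reflectedInverse_eq hs
    obtain ⟨t', -, htb', -, h4', h5'⟩ := (hS i).exists_reflectedInverse_eq hs
    have e1 := hi' s hs
    rw [h4, h4'] at e1
    have e2 := hηQ (-t) (Ioo_subset_Icc_self htb) (-t') (Ioo_subset_Icc_self htb') (by
      rwa [dist_neg_neg])
    have e3 := hi (-t') (Ioo_subset_Icc_self htb')
    have d1 := h.deriv_pos (Ioo_subset_Icc_self htb)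
    have d2 := (hS i).deriv_pos (Ioo_subset_Icc_self htb')
    rw [h5, h5']
    have e4 := (dist_triangle (deriv Q (-t)) (deriv Q (-t')) (deriv (S i) (-t'))).trans_lt
      (add_lt_add e2 e3)
    set p := deriv Q (-t)
    set q := deriv (S i) (-t')
    rw [Real.dist_eq] at e4 ⊢
    have e5 : p⁻¹ - q⁻¹ = (q - p) / (p * q) := by
      have : p ≠ 0 := by linarith
      have : q ≠ 0 := by linarith
      field_simp
    have hpq : 1 / 4 ≤ p * q := by nlinarith
    rw [e5, abs_div, abs_of_pos (by linarith : 0 < p * q), div_lt_iff₀ (by linarith), abs_sub_comm]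
    nlinarith
  have hdL : ContinuousOn (deriv (reflectedInverse Q b)) (Icc 0 b) := fun s hs =>
    (h.contDiffAt_reflectedInverse_of_mem hs).deriv_infty.continuousAt.continuousWithinAt
  have hneg : ∀ {x}, x ∈ Icc 0 b → -x ∈ Icc (-b) b := fun hx =>
    ⟨by linarith [hx.2], by linarith [hx.1]⟩
  have hLeft := tendstoUniformlyOn_pullbackLim (fun i => (hS i).leftContraction)
    h.leftContraction hdL (Metric.tendstoUniformlyOn_iff.2 hL0) hL1
    (v := fun i => reflectField (cubicField (A' i) (B' i))) (w := reflectField (cubicField A B))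
    (hcc.comp continuous_neg).neg.continuousOn
    (Metric.tendstoUniformlyOn_iff.2 fun ε hε => by
      filter_upwards [Metric.tendstoUniformlyOn_iff.1 hcubic ε hε] with i hi x hx
      simp only [reflectField, dist_neg_neg]
      exact hi (-x) (hneg hx)) hK0 (fun i => (hK (hS i)).2) (hK h).2
  rw [Metric.tendstoUniformlyOn_iff] at hRight hLeft ⊢
  intro ε hε
  filter_upwards [hRight ε hε, hLeft ε hε] with i hi1 hi2 x hx
  rcases le_or_gt 0 x with hx0 | hx0
  · rw [invariantField_of_nonneg hx0, invariantField_of_nonneg hx0]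
    exact hi1 x ⟨hx0, hx.2.le⟩
  · have hx' : 0 < -x := by linarith
    have := hi2 (-x) ⟨hx'.le, by linarith [hx.1]⟩
    rw [← reflectField_invariantField hx', ← reflectField_invariantField hx'] at this
    simpa [reflectField] using this

end ParabolicExpansion

/-! ### Uniform expansions for `C^4`-close maps, and the case of negative second derivative. -/

theorem IsParabolicOn.contDiffAt {P : ℝ → ℝ} {U : Set ℝ} (hP : IsParabolicOn P U) {x : ℝ}
    (hx : x ∈ U) : ContDiffAt ℝ ∞ P x := hP.smooth.contDiffAt (hP.isOpen.mem_nhds hx)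

/-- The derivatives of `x - A x ^ 2 + B x ^ 3`. -/
def cubicDeriv (A B : ℝ) : ℕ → ℝ → ℝ
  | 0, x => x - A * x ^ 2 + B * x ^ 3
  | 1, x => 1 - 2 * A * x + 3 * B * x ^ 2
  | 2, x => -2 * A + 6 * B * x
  | 3, _ => 6 * B
  | _, _ => 0

theorem hasDerivAt_cubicDeriv (A B : ℝ) {j : ℕ} (hj : j < 4) (x : ℝ) :
    HasDerivAt (cubicDeriv A B j) (cubicDeriv A B (j + 1) x) x := by
  have h1 := hasDerivAt_id x
  have h2 := hasDerivAt_pow 2 x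
  have h3 := hasDerivAt_pow 3 x
  interval_cases j
  · exact ((h1.sub (h2.const_mul A)).add (h3.const_mul B)).congr_deriv
      (by simp [cubicDeriv]; ring)
  · exact (((h1.const_mul (2 * A)).const_sub 1).add (h2.const_mul (3 * B))).congr_deriv
      (by simp [cubicDeriv]; ring)
  · exact ((h1.const_mul (6 * B)).const_add (-2 * A)).congr_deriv (by simp [cubicDeriv])
  · exact hasDerivAt_const x _

/-- All maps that are `C^4`-close to a given parabolic map expand with uniform constants. -/
theorem IsParabolicOn.exists_expansion {P : ℝ → ℝ} {U : Set ℝ} (hP : IsParabolicOn P U)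
    (hneg : iteratedDeriv 2 P 0 < 0) :
    ∃ α M b δ : ℝ, 0 < δ ∧ Icc (-b) b ⊆ U ∧ ∀ Q, IsParabolicOn Q U → CkClose 4 P Q U δ →
      ParabolicExpansion Q α (-iteratedDeriv 2 Q 0 / 2) (iteratedDeriv 3 Q 0 / 6) M b := by
  obtain ⟨r, hr, hrU⟩ := Metric.nhds_basis_closedBall.mem_iff.1 (hP.isOpen.mem_nhds hP.zero_mem)
  rw [Real.closedBall_eq_Icc, zero_sub, zero_add] at hrU
  have hbd : ∀ j, ∃ C, ∀ x ∈ Icc (-r) r, |iteratedDeriv j P x| ≤ C := fun j =>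
    isCompact_Icc.exists_bound_of_continuousOn fun x hx =>
      ((hP.contDiffAt (hrU hx)).nat_of_infty (j + 1)).hasDerivAt_iteratedDeriv.continuousAt
        |>.continuousWithinAt
  choose C hC using hbd
  have h0r : (0 : ℝ) ∈ Icc (-r) r := ⟨by linarith, hr.le⟩
  have hC0 : ∀ j, 0 ≤ C j := fun j => (abs_nonneg _).trans (hC j 0 h0r)
  set a := iteratedDeriv 2 P 0 with ha
  set M := C 2 + C 3 + C 4 + 1 with hM
  have hM1 : 1 ≤ M := by linarith [hC0 2, hC0 3, hC0 4]
  set α := -a / 4 with hα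
  have hα0 : 0 < α := by rw [hα]; linarith
  set b := min r (min (α / (16 * M)) (1 / (16 * M))) with hb
  have hb0 : 0 < b := by rw [hb]; positivity
  have hbr : Icc (-b) b ⊆ Icc (-r) r :=
    Icc_subset_Icc (neg_le_neg (min_le_left _ _)) (min_le_left _ _)
  -- Closeness `-a / 2` keeps `Q'' 0 < a / 2`, so the coefficient `A` of `Q` exceeds `α = -a / 4`.
  -- Closeness `1` gives the derivative bounds `C j + 1`, which `M` dominates for `j = 2, 3, 4`.
  refine ⟨α, M, b, min 1 (-a / 2), lt_min one_pos (by linarith), hbr.trans hrU, fun Q hQ hPQ => ?_⟩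
  have hcl : ∀ j ≤ 4, ∀ x ∈ Icc (-r) r, |iteratedDeriv j Q x| ≤ C j + 1 := by
    intro j hj x hx
    have h1 := (hPQ j hj x (hrU hx)).trans_le (min_le_left _ _)
    have h2 := hC j x hx
    have h3 := abs_add_le (iteratedDeriv j Q x - iteratedDeriv j P x) (iteratedDeriv j P x)
    rw [sub_add_cancel] at h3
    linarith
  have h2 := abs_lt.1 ((hPQ 2 (by norm_num) 0 hP.zero_mem).trans_le (min_le_right _ _))
  rw [← ha] at h2
  have h2M := abs_le.1 (hcl 2 (by norm_num) 0 h0r)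
  have h3M := hcl 3 (by norm_num) 0 h0r
  set A := -iteratedDeriv 2 Q 0 / 2 with hA
  set B := iteratedDeriv 3 Q 0 / 6 with hB
  -- Subtracting the cubic Taylor polynomial makes the derivatives of order below four vanish at `0`
  -- without changing the fourth.
  have tower := abs_le_of_deriv_tower (S := Icc (-b) b) ordConnected_Icc ⟨by linarith, hb0.le⟩
    (F := fun j x => iteratedDeriv j Q x - cubicDeriv A B j x) (N := 4) (C := M)
    (fun j hj x hx => ((hQ.contDiffAt (hrU (hbr hx))).nat_of_infty
      (j + 1)).hasDerivAt_iteratedDeriv.sub (hasDerivAt_cubicDeriv A B hj x))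
    (fun j hj => by
      interval_cases j
      · simp [cubicDeriv, hQ.map_zero]
      · simp [cubicDeriv, hQ.deriv_zero]
      · simp [cubicDeriv, hA]; ring
      · simp [cubicDeriv, hB]; ring)
    (fun x hx => by
      have := hcl 4 le_rfl x (hbr hx)
      simp only [cubicDeriv, sub_zero]
      linarith [hC0 2, hC0 3])
  refine ⟨hα0, by rw [hα, hA]; linarith [h2.2], by rw [hA]; linarith [h2M.1, hC0 2, hC0 3, hC0 4],
    ?_, hM1, hb0, ?_, ?_, hQ.map_zero, fun x hx => hQ.contDiffAt (hrU (hbr hx)), fun x hx => ?_,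
    fun x hx => ?_⟩
  · rw [hB, abs_div, abs_of_pos (by norm_num : (0 : ℝ) < 6), div_le_iff₀ (by norm_num)]
    linarith [hC0 2, hC0 3, hC0 4]
  · have : b ≤ α / (16 * M) := (min_le_right _ _).trans (min_le_left _ _)
    rw [le_div_iff₀ (by positivity)] at this
    linarith
  · have : b ≤ 1 / (16 * M) := (min_le_right _ _).trans (min_le_right _ _)
    rw [le_div_iff₀ (by positivity)] at this
    linarith
  · have := tower 4 le_rfl x hx
    rw [Even.pow_abs ⟨2, rfl⟩] at this
    simpa [cubicDeriv] using this
  · have := tower 3 (by norm_num) x hx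
    simpa [cubicDeriv] using this

theorem ckClose_self (k : ℕ) (P : ℝ → ℝ) (U : Set ℝ) {δ : ℝ} (hδ : 0 < δ) : CkClose k P P U δ :=
  fun j _ x _ => by simpa using hδ

theorem CkClose.mono {k : ℕ} {P Q : ℝ → ℝ} {U : Set ℝ} {δ δ' : ℝ} (h : CkClose k P Q U δ)
    (hδ : δ ≤ δ') : CkClose k P Q U δ' := fun j hj x hx => (h j hj x hx).trans_le hδ

theorem exists_generator_of_neg (P : ℝ → ℝ) (U : Set ℝ) (hP : IsParabolicOn P U)
    (hneg : iteratedDeriv 2 P 0 < 0) :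
    ∃ V : Set ℝ, IsOpen V ∧ V.OrdConnected ∧ (0 : ℝ) ∈ V ∧ V ⊆ U ∧
      (∃ u : ℝ → ℝ, IsGeneratorOn u P V) ∧
      ∀ ε > 0, ∃ δ > 0, ∀ Q : ℝ → ℝ, IsParabolicOn Q U → CkClose 4 P Q U δ →
        (∃ v : ℝ → ℝ, IsGeneratorOn v Q V) ∧
        ∀ u v : ℝ → ℝ, IsGeneratorOn u P V → IsGeneratorOn v Q V →
          CkClose 0 u v V ε := by
  obtain ⟨α, M, b, δ₀, hδ₀, hbU, hexp⟩ := hP.exists_expansion hneg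
  have h2 : ∀ Q : ℝ → ℝ, iteratedDeriv 2 Q 0 = -2 * (-iteratedDeriv 2 Q 0 / 2) := fun Q => by ring
  set I : (ℝ → ℝ) → ℝ → ℝ := fun Q =>
    invariantField Q (-iteratedDeriv 2 Q 0 / 2) (iteratedDeriv 3 Q 0 / 6) b with hI
  have hP' := hexp P hP (ckClose_self 4 P U hδ₀)
  refine ⟨Ioo (-b) b, isOpen_Ioo, ordConnected_Ioo, hP'.zero_mem, Ioo_subset_Icc_self.trans hbU,
    ⟨I P, hP'.isGeneratorOn_invariantField (h2 P)⟩, fun ε hε => ?_⟩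
  -- If no `δ` worked, maps at distance `1 / (n + 1)` would form a sequence to which the uniform
  -- convergence of the invariant fields applies. The cap `δ₀` keeps them in the range of the common
  -- expansion.
  have key : ∃ δ > 0, ∀ Q : ℝ → ℝ, IsParabolicOn Q U → CkClose 4 P Q U (min δ δ₀) →
      ∀ x ∈ Ioo (-b) b, |I Q x - I P x| < ε := by
    by_contra! hcon
    have hδ : ∀ n : ℕ, 0 < 1 / ((n : ℝ) + 1) := fun n => Nat.one_div_pos_of_nat
    choose S hSU hSc x hx hxε using fun n : ℕ => hcon (1 / ((n : ℝ) + 1)) (hδ n)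
    have hS := fun n => hexp (S n) (hSU n) ((hSc n).mono (min_le_right _ _))
    have hlt : ∀ n, ∀ j ≤ 4, ∀ y ∈ U,
        |iteratedDeriv j (S n) y - iteratedDeriv j P y| < 1 / ((n : ℝ) + 1) := fun n j hj y hy =>
      (hSc n j hj y hy).trans_le (min_le_left _ _)
    have htend : ∀ j ≤ 4, Tendsto (fun n => iteratedDeriv j (S n) 0) atTop
        (𝓝 (iteratedDeriv j P 0)) := fun j hj => by
      refine tendsto_iff_dist_tendsto_zero.2 (squeeze_zero (fun _ => dist_nonneg)
        (fun n => (hlt n j hj 0 hP.zero_mem).le) tendsto_one_div_add_atTop_nhds_zero_nat)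
    have hunif : ∀ j ≤ 4, TendstoUniformlyOn (fun n => iteratedDeriv j (S n)) (iteratedDeriv j P)
        atTop (Icc (-b) b) := fun j hj => by
      rw [Metric.tendstoUniformlyOn_iff]
      intro η hη
      filter_upwards [tendsto_one_div_add_atTop_nhds_zero_nat.eventually (gt_mem_nhds hη)]
        with n hn y hy
      rw [dist_comm]
      exact (hlt n j hj y (hbU hy)).trans hn
    have h0 := hunif 0 (by norm_num)
    have h1 := hunif 1 (by norm_num)
    simp only [iteratedDeriv_zero, iteratedDeriv_one] at h0 h1
    have := hP'.tendstoUniformlyOn_invariantField hS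
      ((htend 2 (by norm_num)).neg.div_const 2) ((htend 3 (by norm_num)).div_const 6) h0 h1
    obtain ⟨n, hn⟩ := (Metric.tendstoUniformlyOn_iff.1 this ε hε).exists
    have := hn (x n) (hx n)
    rw [dist_comm, Real.dist_eq] at this
    exact absurd this (hxε n).not_gt
  obtain ⟨δ, hδ, hδε⟩ := key
  refine ⟨min δ δ₀, lt_min hδ hδ₀, fun Q hQ hPQ => ?_⟩
  have hQ' := hexp Q hQ (hPQ.mono (min_le_right _ _))
  refine ⟨⟨I Q, hQ'.isGeneratorOn_invariantField (h2 Q)⟩, fun u v hu hv j hj x hx => ?_⟩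
  obtain rfl : j = 0 := by omega
  rw [iteratedDeriv_zero, iteratedDeriv_zero, hQ'.eq_invariantField (h2 Q) hv hx,
    hP'.eq_invariantField (h2 P) hu hx]
  exact hδε Q hQ hPQ x hx

/-! ### Reflection, and the general case. -/

theorem iteratedDeriv_reflectField (j : ℕ) (f : ℝ → ℝ) (x : ℝ) :
    iteratedDeriv j (reflectField f) x = -((-1) ^ j * iteratedDeriv j f (-x)) := by
  unfold reflectField
  rw [iteratedDeriv_fun_neg, iteratedDeriv_comp_neg, smul_eq_mul]

theorem ContDiffOn.reflectField {f : ℝ → ℝ} {U : Set ℝ} (hf : ContDiffOn ℝ ∞ f U) :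
    ContDiffOn ℝ ∞ (reflectField f) (Neg.neg ⁻¹' U) :=
  (hf.comp contDiff_neg.contDiffOn fun _ hx => hx).neg

theorem IsParabolicOn.reflectField {P : ℝ → ℝ} {U : Set ℝ} (hP : IsParabolicOn P U) :
    IsParabolicOn (reflectField P) (Neg.neg ⁻¹' U) where
  isOpen := hP.isOpen.preimage continuous_neg
  zero_mem := by simpa using hP.zero_mem
  smooth := hP.smooth.reflectField
  map_zero := by simp [_root_.reflectField, hP.map_zero]
  deriv_zero := by
    have := iteratedDeriv_reflectField 1 P 0
    simpa [hP.deriv_zero] using this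
  deriv_two_ne := by
    rw [iteratedDeriv_reflectField]
    simpa using hP.deriv_two_ne

theorem CkClose.reflectField {k : ℕ} {P Q : ℝ → ℝ} {U : Set ℝ} {δ : ℝ} (h : CkClose k P Q U δ) :
    CkClose k (reflectField P) (reflectField Q) (Neg.neg ⁻¹' U) δ := by
  intro j hj x hx
  rw [iteratedDeriv_reflectField, iteratedDeriv_reflectField, neg_sub_neg, ← mul_sub, abs_mul,
    abs_pow, abs_neg, abs_one, one_pow, one_mul, abs_sub_comm]
  exact h j hj (-x) hx

theorem IsGeneratorOn.reflectField {u P : ℝ → ℝ} {V : Set ℝ} (h : IsGeneratorOn u P V) :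
    IsGeneratorOn (reflectField u) (reflectField P) (Neg.neg ⁻¹' V) where
  smooth := h.smooth.reflectField
  map_zero := by simp [_root_.reflectField, h.map_zero]
  deriv_zero := by
    have := iteratedDeriv_reflectField 1 u 0
    simpa [h.deriv_zero] using this
  deriv_two := by
    rw [iteratedDeriv_reflectField, iteratedDeriv_reflectField, neg_zero, h.deriv_two]
  timeOne := by
    rw [timeOneMapOn_iff]
    intro x hx hPx
    have hPx' : P (-x) ∈ V := by simpa [_root_.reflectField] using hPx
    have h1 := ((timeOneMapOn_iff _ _ _).1 h.timeOne (-x) hx hPx').reflect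
      (W := Neg.neg ⁻¹' V) fun z hz => by simpa using hz
    rwa [neg_neg] at h1

/-- Conjugation by `x ↦ -x` changes the sign of the second derivative at `0`, carries generators to
generators and preserves closeness, so the positive case follows from the negative one. -/
theorem proposition3p2 (P : ℝ → ℝ) (U : Set ℝ) (hP : IsParabolicOn P U) :
    ∃ V : Set ℝ, IsOpen V ∧ V.OrdConnected ∧ (0 : ℝ) ∈ V ∧ V ⊆ U ∧
      (∃ u : ℝ → ℝ, IsGeneratorOn u P V) ∧
      ∀ ε > 0, ∃ δ > 0, ∀ Q : ℝ → ℝ, IsParabolicOn Q U → CkClose 4 P Q U δ →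
        (∃ v : ℝ → ℝ, IsGeneratorOn v Q V) ∧
        ∀ u v : ℝ → ℝ, IsGeneratorOn u P V → IsGeneratorOn v Q V →
          CkClose 0 u v V ε := by
  rcases hP.deriv_two_ne.lt_or_gt with hneg | hpos
  · exact exists_generator_of_neg P U hP hneg
  have hneg : iteratedDeriv 2 (reflectField P) 0 < 0 := by
    rw [iteratedDeriv_reflectField]
    simpa using hpos
  have hback : ∀ S : Set ℝ, Neg.neg ⁻¹' (Neg.neg ⁻¹' S) = S := fun S => by
    ext x; simp
  have hgen : ∀ {u Q : ℝ → ℝ} {V : Set ℝ}, IsGeneratorOn u (reflectField Q) V →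
      IsGeneratorOn (reflectField u) Q (Neg.neg ⁻¹' V) := fun {u Q V} hu => by
    simpa only [reflectField_reflectField] using hu.reflectField
  obtain ⟨V, hVo, hVc, h0V, hVU, ⟨u, hu⟩, hε⟩ :=
    exists_generator_of_neg _ _ hP.reflectField hneg
  refine ⟨Neg.neg ⁻¹' V, hVo.preimage continuous_neg,
    hVc.preimage_anti fun _ _ h => neg_le_neg h, by simpa using h0V, ?_,
    ⟨reflectField u, hgen hu⟩, fun ε hε0 => ?_⟩
  · rw [← hback U]
    exact preimage_mono hVU
  obtain ⟨δ, hδ, hδQ⟩ := hε ε hε0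
  refine ⟨δ, hδ, fun Q hQ hPQ => ?_⟩
  obtain ⟨⟨v, hv⟩, huv⟩ := hδQ _ hQ.reflectField hPQ.reflectField
  refine ⟨⟨reflectField v, hgen hv⟩, fun u' v' hu' hv' => ?_⟩
  have hu1 := hu'.reflectField
  have hv1 := hv'.reflectField
  rw [hback] at hu1 hv1
  simpa only [reflectField_reflectField] using (huv _ _ hu1 hv1).reflectField
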